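/- Let $G$ be a group, let $B_G$ be an Eilenberg–MacLane space for $G$ (a based connected CW complex with $\pi_1(B_G)\cong G$ and $\pi_i(B_G)=0$ for $i\ge 2$), and write $H_*(G)=H_*(B_G)$, $H^*(G)=H^*(B_G)$ (integer coefficients). Let $\alpha\in H_4(G)$. Let $M$ be a closed connected oriented topological 4-manifold with orientation class $[M]\in H_4(M)$, let $\phi\colon\pi_1(M)\to G$ be an isomorphism, let $f\colon M\to B_G$ be a based map inducing $\phi$, and suppose $f_*([M])=\alpha$. The intersection form of $M$ is the form $(x,y)\mapsto (x\cup y)\cap[M]$ on $H^2(M)/\mathrm{torsion}$. Let $I(M,f)\subset H^2(M)/\mathrm{torsion}$ be the image of the composite $H^2(G)\xrightarrow{f^*}H^2(M)\to H^2(M)/\mathrm{torsion}$. For an integral bilinear form $F$ on an abelian group $V$, let $b^+(F)$ (respectively $b^-(F)$) denote the maximal dimension of a real subspace of $V\otimes\mathbb R$ on which $F$ is positive (respectively negative) definite; call $F$ even if $F(v,v)$ is even for all $v\in V$, and call a subgroup $W\subset V$ isotropic for $F$ if $F(w_1,w_2)=0$ for all $w_1,w_2\in W$. Write $b^\pm(M)$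 and $b^\pm(I(M,f))$ for the values of $b^\pm$ on the intersection form of $M$ and on its restriction to $I(M,f)$. Then $f^*\colon H^2(G)\to H^2(M)$ is injective, and the restriction of the intersection form of $M$ to $I(M,f)$ depends only on $G$ and $\alpha$: it is given by the pairing $$H^2(G)\times H^2(G)\to\mathbb Z,\qquad (x,y)\mapsto (x\cup y)\cap\alpha, \tag{1}$$ that is, $(f^*x\cup f^*y)\cap[M]=(x\cup y)\cap\alpha$ for all $x,y\in H^2(G)$, and $f^*$ induces an isomorphism $H^2(G)/\mathrm{torsion}\cong I(M,f)$ that carries the form induced by (1) to the restriction of the intersection form. Moreover: 1. $b^+(M)\ge b^+(I(M,f))$ and $b^-(M)\ge b^-(I(M,f))$. 2. If a subgroup $W\subset H^2(G)$ is isotropic for (1), then its image in $I(M,f)$ is isotropic for the intersection form of $M$. 3. If (1) is even, then the restriction of the intersection form of $M$ to $I(M,f)$ is even. 4. If $I(M,f)=H^2(M)/\mathrm{torsion}$ (for instance, if $f^*\colon H^2(G)\to H^2(M)$ is surjective), then the intersection form of $M$ is determined by $\alpha$: $f^*$ induces an isomorphism from $H^2(G)/\mathrm{torsion}$, with the form induced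 by (1), to $H^2(M)/\mathrm{torsion}$ with the intersection form. -/

import Mathlib

open scoped TensorProduct

noncomputable section

namespace GroupGeography

/-! ### Singular chains and cochains with integer coefficients -/

/-- Singular `n`-simplices of `X`. -/
abbrev Simplex (n : ℕ) (X : Type*) [TopologicalSpace X] : Type _ :=
  C(stdSimplex ℝ (Fin (n + 1)), X)

/-- Precomposition of a singular simplex with the affine map of standard simplices given on
vertices by `v`. -/
def Simplex.pull {m n : ℕ} {X : Type*} [TopologicalSpace X] (v : Fin (m + 1) → Fin (n + 1))
    (s : Simplex n X) : Simplex m X :=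
  s.comp ⟨stdSimplex.map v, stdSimplex.continuous_map v⟩

/-- The `i`-th face of a singular simplex (the one opposite to the vertex `i`). -/
def Simplex.face {n : ℕ} {X : Type*} [TopologicalSpace X] (i : Fin (n + 2))
    (s : Simplex (n + 1) X) : Simplex n X :=
  s.pull i.succAbove

/-- The front `p`-face, spanned by the vertices `0, …, p`. -/
def Simplex.front {p q n : ℕ} (h : p + q = n) {X : Type*} [TopologicalSpace X]
    (s : Simplex n X) : Simplex p X :=
  s.pull fun i => ⟨i, by omega⟩

/-- The back `q`-face, spanned by the vertices `p, …, p + q`. -/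
def Simplex.back {p q n : ℕ} (h : p + q = n) {X : Type*} [TopologicalSpace X]
    (s : Simplex n X) : Simplex q X :=
  s.pull fun i => ⟨p + i, by omega⟩

/-- Singular `n`-chains: finite integral combinations of singular `n`-simplices. -/
abbrev Chain (n : ℕ) (X : Type*) [TopologicalSpace X] : Type _ := Simplex n X →₀ ℤ

/-- Singular `n`-cochains. -/
abbrev Cochain (n : ℕ) (X : Type*) [TopologicalSpace X] : Type _ := Simplex n X → ℤ

/-- `∂ s = ∑ᵢ (-1)ⁱ (i-th face of s)`. -/
def boundary (n : ℕ) (X : Type*) [TopologicalSpace X] : Chain (n + 1) X →ₗ[ℤ] Chain n X :=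
  ∑ i : Fin (n + 2), ((-1) ^ (i : ℕ) : ℤ) • Finsupp.lmapDomain ℤ ℤ (Simplex.face i)

/-- `(δ c)(s) = ∑ᵢ (-1)ⁱ c (i-th face of s)`. -/
def coboundary (n : ℕ) (X : Type*) [TopologicalSpace X] : Cochain n X →ₗ[ℤ] Cochain (n + 1) X where
  toFun c := fun s => ∑ i : Fin (n + 2), (-1) ^ (i : ℕ) * c (s.face i)
  map_add' c d := by
    funext s
    simp [mul_add, Finset.sum_add_distrib]
  map_smul' k c := by
    funext s
    simp only [Pi.smul_apply, smul_eq_mul, RingHom.id_apply, Finset.mul_sum]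
    exact Finset.sum_congr rfl fun i _ => by ring

/-- The linear extension of a cochain to chains. -/
def evalChain {n : ℕ} {X : Type*} [TopologicalSpace X] : Cochain n X →ₗ[ℤ] Chain n X →ₗ[ℤ] ℤ where
  toFun c := Finsupp.linearCombination ℤ c
  map_add' c d := by
    ext s
    simp
  map_smul' k c := by
    ext s
    simp

/-- Chains all of whose simplices lie in `A`. -/
def chainsIn (n : ℕ) {X : Type*} [TopologicalSpace X] (A : Set X) : Submodule ℤ (Chain n X) :=
  Finsupp.supported ℤ ℤ {s : Simplex n X | Set.range s ⊆ A}

/-! ### Homology and cohomology -/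

/-- The cycles; every `0`-chain is one. -/
def cycles : (n : ℕ) → (X : Type*) → [TopologicalSpace X] → Submodule ℤ (Chain n X)
  | 0, _, _ => ⊤
  | n + 1, X, _ => LinearMap.ker (boundary n X)

/-- The cycles relative to `A`: chains whose boundary lies in `A`. -/
def relCycles : (n : ℕ) → {X : Type*} → [TopologicalSpace X] → (A : Set X) →
    Submodule ℤ (Chain n X)
  | 0, _, _, _ => ⊤
  | n + 1, X, _, A => (chainsIn n A).comap (boundary n X)

/-- The cocycles. -/
def cocycles (n : ℕ) (X : Type*) [TopologicalSpace X] : Submodule ℤ (Cochain n X) :=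
  LinearMap.ker (coboundary n X)

/-- The coboundaries; in degree `0` only the zero cochain is one. -/
def coboundaries : (n : ℕ) → (X : Type*) → [TopologicalSpace X] → Submodule ℤ (Cochain n X)
  | 0, _, _ => ⊥
  | n + 1, X, _ => LinearMap.range (coboundary n X)

/-- Integral singular homology `H_n(X)`. -/
abbrev Homology (n : ℕ) (X : Type*) [TopologicalSpace X] : Type _ :=
  cycles n X ⧸ (LinearMap.range (boundary n X)).submoduleOf (cycles n X)

/-- Integral relative singular homology `H_n(X, A)`. -/
abbrev RelHomology (n : ℕ) {X : Type*} [TopologicalSpace X] (A : Set X) : Type _ :=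
  relCycles n A ⧸ (LinearMap.range (boundary n X) ⊔ chainsIn n A).submoduleOf (relCycles n A)

/-- Integral singular cohomology `H^n(X)`. -/
abbrev Cohomology (n : ℕ) (X : Type*) [TopologicalSpace X] : Type _ :=
  cocycles n X ⧸ (coboundaries n X).submoduleOf (cocycles n X)

theorem cycles_le_relCycles (n : ℕ) {X : Type*} [TopologicalSpace X] (A : Set X) :
    cycles n X ≤ relCycles n A := by
  cases n with
  | zero => exact le_rfl
  | succ n =>
    intro c hc
    have hc' : boundary n X c = 0 := hc
    change boundary n X c ∈ chainsIn n A
    rw [hc']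
    exact Submodule.zero_mem _

/-- The map `H_n(X) → H_n(X, A)`. -/
def toRel (n : ℕ) {X : Type*} [TopologicalSpace X] (A : Set X) :
    Homology n X →ₗ[ℤ] RelHomology n A :=
  Submodule.mapQ _ _ (Submodule.inclusion (cycles_le_relCycles n A)) fun _ hc =>
    Submodule.mem_sup_left hc

/-! ### Functoriality -/

section Functoriality

variable {X Y : Type*} [TopologicalSpace X] [TopologicalSpace Y]

/-- The chain map induced by a continuous map. -/
def chainMap (n : ℕ) (f : C(X, Y)) : Chain n X →ₗ[ℤ] Chain n Y :=
  Finsupp.lmapDomain ℤ ℤ fun s : Simplex n X => f.comp s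

/-- The cochain map induced by a continuous map. -/
def cochainMap (n : ℕ) (f : C(X, Y)) : Cochain n Y →ₗ[ℤ] Cochain n X :=
  LinearMap.funLeft ℤ ℤ fun s : Simplex n X => f.comp s

theorem boundary_chainMap (n : ℕ) (f : C(X, Y)) (c : Chain (n + 1) X) :
    boundary n Y (chainMap (n + 1) f c) = chainMap n f (boundary n X c) := by
  suffices h : boundary n Y ∘ₗ chainMap (n + 1) f = chainMap n f ∘ₗ boundary n X from
    LinearMap.congr_fun h c
  refine Finsupp.lhom_ext fun s k => ?_
  simp only [boundary, chainMap, LinearMap.comp_apply, LinearMap.sum_apply, LinearMap.smul_apply,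
    map_sum, map_smul, Finsupp.lmapDomain_apply, Finsupp.mapDomain_single]
  rfl

theorem coboundary_cochainMap (n : ℕ) (f : C(X, Y)) (c : Cochain n Y) :
    coboundary n X (cochainMap n f c) = cochainMap (n + 1) f (coboundary n Y c) := rfl

theorem chainMap_mem_cycles (n : ℕ) (f : C(X, Y)) {c : Chain n X} (hc : c ∈ cycles n X) :
    chainMap n f c ∈ cycles n Y := by
  cases n with
  | zero => exact Submodule.mem_top
  | succ n =>
    have hc' : boundary n X c = 0 := hc
    change boundary n Y _ = 0
    rw [boundary_chainMap, hc', map_zero]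

theorem cochainMap_mem_cocycles (n : ℕ) (f : C(X, Y)) {c : Cochain n Y} (hc : c ∈ cocycles n Y) :
    cochainMap n f c ∈ cocycles n X := by
  have hc' : coboundary n Y c = 0 := hc
  change coboundary n X _ = 0
  rw [coboundary_cochainMap, hc', map_zero]

theorem cochainMap_mem_coboundaries (n : ℕ) (f : C(X, Y)) {c : Cochain n Y}
    (hc : c ∈ coboundaries n Y) : cochainMap n f c ∈ coboundaries n X := by
  cases n with
  | zero =>
    have hc' : c = 0 := hc
    change _ = 0
    rw [hc', map_zero]
  | succ n =>
    obtain ⟨d, rfl⟩ := hc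
    exact ⟨cochainMap n f d, coboundary_cochainMap n f d⟩

/-- The induced map `f_* : H_n(X) → H_n(Y)`. -/
def Homology.map (n : ℕ) (f : C(X, Y)) : Homology n X →ₗ[ℤ] Homology n Y :=
  Submodule.mapQ _ _ ((chainMap n f).restrict fun _ hc => chainMap_mem_cycles n f hc) <| by
    rintro ⟨c, _⟩ ⟨d, hd⟩
    exact ⟨chainMap (n + 1) f d, (boundary_chainMap n f d).trans (congrArg (chainMap n f) hd)⟩

/-- The induced map `f^* : H^n(Y) → H^n(X)`. -/
def Cohomology.map (n : ℕ) (f : C(X, Y)) : Cohomology n Y →ₗ[ℤ] Cohomology n X :=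
  Submodule.mapQ _ _ ((cochainMap n f).restrict fun _ hc => cochainMap_mem_cocycles n f hc)
    fun _ hc => cochainMap_mem_coboundaries n f hc

end Functoriality

/-! ### Evaluation and cup product -/

section Products

variable {X : Type*} [TopologicalSpace X]

theorem evalChain_boundary (n : ℕ) (c : Cochain n X) (d : Chain (n + 1) X) :
    evalChain c (boundary n X d) = evalChain (coboundary n X c) d := by
  suffices h : evalChain c ∘ₗ boundary n X = evalChain (coboundary n X c) from
    LinearMap.congr_fun h d
  refine Finsupp.lhom_ext fun s k => ?_
  simp only [boundary, evalChain, coboundary, LinearMap.comp_apply, LinearMap.sum_apply,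
    LinearMap.smul_apply, map_sum, map_smul, Finsupp.lmapDomain_apply, Finsupp.mapDomain_single,
    LinearMap.coe_mk, AddHom.coe_mk, Finsupp.linearCombination_single, smul_eq_mul, Finset.mul_sum]
  exact Finset.sum_congr rfl fun i _ => by ring

/-- The Kronecker evaluation `H^n(X) × H_n(X) → ℤ`, that is, the cap product `H^n × H_n → H_0`
followed by the augmentation `H_0 → ℤ`; for connected `X` this is `(x, a) ↦ x ∩ a ∈ ℤ`. -/
def capEval (n : ℕ) : Cohomology n X →ₗ[ℤ] Homology n X →ₗ[ℤ] ℤ :=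
  LinearMap.liftQ₂ _ _
    (evalChain.compl₁₂ (cocycles n X).subtype (cycles n X).subtype)
    (by
      rintro ⟨c, _⟩ hc
      rw [LinearMap.mem_ker]
      refine LinearMap.ext fun d => ?_
      change evalChain c d.1 = 0
      cases n with
      | zero =>
        have hc' : c = 0 := hc
        simp [hc']
      | succ n =>
        obtain ⟨b, hb⟩ := hc
        have hb' : coboundary n X b = c := hb
        have hd : boundary n X d.1 = 0 := d.2
        rw [← hb', ← evalChain_boundary, hd, map_zero])
    (by
      rintro ⟨d, _⟩ ⟨b, hb⟩
      have hb' : boundary n X b = d := hb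
      rw [LinearMap.mem_ker]
      refine LinearMap.ext fun c => ?_
      change evalChain c.1 d = 0
      have hc : coboundary n X c.1 = 0 := c.2
      rw [← hb', evalChain_boundary, hc]
      simp)

/-- The cup product of cochains, `(c ∪ d)(s) = c (front face of s) * d (back face of s)`. -/
def cupCochain {p q n : ℕ} (h : p + q = n) : Cochain p X →ₗ[ℤ] Cochain q X →ₗ[ℤ] Cochain n X :=
  LinearMap.mk₂ ℤ (fun c d s => c (s.front h) * d (s.back h))
    (fun _ _ _ => funext fun _ => add_mul _ _ _)
    (fun _ _ _ => funext fun _ => mul_assoc _ _ _)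
    (fun _ _ _ => funext fun _ => mul_add _ _ _)
    (fun _ _ _ => funext fun _ => mul_left_comm _ _ _)

theorem Simplex.pull_pull {l m n : ℕ} (v : Fin (l + 1) → Fin (m + 1))
    (w : Fin (m + 1) → Fin (n + 1)) (s : Simplex n X) : (s.pull w).pull v = s.pull (w ∘ v) := by
  ext x
  exact congrArg s (stdSimplex.map_comp_apply v w x)

theorem coboundary_cup {p q n : ℕ} (h : p + q = n) (c : Cochain p X) (d : Cochain q X) :
    coboundary n X (cupCochain h c d) =
      cupCochain (by omega) (coboundary p X c) d +
        ((-1) ^ p : ℤ) • cupCochain (by omega) c (coboundary q X d) := by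
  subst h
  funext s
  have hp : p + 1 + q = p + q + 1 := by omega
  have hq : p + (q + 1) = p + q + 1 := rfl
  have hpq : p + 1 + (q + 1) = p + q + 2 := by omega
  have front_low (i : Fin (p + 1)) : (s.face (Fin.cast hpq (Fin.castAdd (q + 1) i))).front rfl =
      (s.front hp).face i.castSucc := by
    simp only [Simplex.face, Simplex.front, Simplex.pull_pull]
    congr 1
    funext k
    apply Fin.ext
    simp only [Function.comp_apply, Fin.succAbove, Fin.lt_def, Fin.val_castSucc, Fin.val_cast,
      Fin.val_castAdd]
    split_ifs <;> simp
  have back_low (i : Fin (p + 1)) :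
      (s.face (Fin.cast hpq (Fin.castAdd (q + 1) i))).back (p := p) (q := q) rfl = s.back hp := by
    simp only [Simplex.face, Simplex.back, Simplex.pull_pull]
    congr 1
    funext k
    apply Fin.ext
    have := i.2
    simp only [Function.comp_apply, Fin.succAbove, Fin.lt_def, Fin.val_castSucc, Fin.val_cast,
      Fin.val_castAdd]
    split_ifs <;> simp <;> omega
  have front_high (j : Fin (q + 1)) :
      (s.face (Fin.cast hpq (Fin.natAdd (p + 1) j))).front (p := p) (q := q) rfl =
        s.front hq := by
    simp only [Simplex.face, Simplex.front, Simplex.pull_pull]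
    congr 1
    funext k
    apply Fin.ext
    have := k.2
    simp only [Function.comp_apply, Fin.succAbove, Fin.lt_def, Fin.val_castSucc, Fin.val_cast,
      Fin.val_natAdd]
    split_ifs <;> simp <;> omega
  have back_high (j : Fin (q + 1)) :
      (s.face (Fin.cast hpq (Fin.natAdd (p + 1) j))).back (p := p) (q := q) rfl =
        (s.back hq).face j.succ := by
    simp only [Simplex.face, Simplex.back, Simplex.pull_pull]
    congr 1
    funext k
    apply Fin.ext
    simp only [Function.comp_apply, Fin.succAbove, Fin.lt_def, Fin.val_castSucc, Fin.val_cast,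
      Fin.val_natAdd, Fin.val_succ]
    split_ifs <;> simp <;> omega
  have front_last : (s.front hp).face (Fin.last (p + 1)) = s.front hq := by
    simp only [Simplex.face, Simplex.front, Simplex.pull_pull]
    congr 1
    funext k
    apply Fin.ext
    simp
  have back_zero : (s.back hq).face 0 = s.back hp := by
    simp only [Simplex.face, Simplex.back, Simplex.pull_pull]
    congr 1
    funext k
    apply Fin.ext
    simp
    omega
  change ∑ i : Fin (p + q + 2), (-1) ^ (i : ℕ) * (c ((s.face i).front rfl) *
      d ((s.face i).back rfl)) =
    (∑ i : Fin (p + 2), (-1) ^ (i : ℕ) * c ((s.front hp).face i)) * d (s.back hp) +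
      (-1) ^ p * (c (s.front hq) *
        ∑ j : Fin (q + 2), (-1) ^ (j : ℕ) * d ((s.back hq).face j))
  rw [← Equiv.sum_comp (finCongr hpq), Fin.sum_univ_add, Fin.sum_univ_castSucc (n := p + 1),
    Fin.sum_univ_succ (n := q + 1)]
  simp only [finCongr_apply, front_low, back_low, front_high, back_high, front_last, back_zero,
    Fin.val_cast, Fin.val_castAdd, Fin.val_natAdd, Fin.val_castSucc, Fin.val_last, Fin.val_succ,
    Fin.val_zero, add_mul, mul_add, Finset.sum_mul, Finset.mul_sum]
  have e₁ : ∀ i : Fin (p + 1), (-1 : ℤ) ^ (i : ℕ) * (c ((s.front hp).face i.castSucc) *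
      d (s.back hp)) = (-1) ^ (i : ℕ) * c ((s.front hp).face i.castSucc) * d (s.back hp) :=
    fun i => by ring
  have e₂ : ∀ j : Fin (q + 1), (-1 : ℤ) ^ (p + 1 + (j : ℕ)) * (c (s.front hq) *
      d ((s.back hq).face j.succ)) =
      (-1) ^ p * (c (s.front hq) * ((-1) ^ ((j : ℕ) + 1) * d ((s.back hq).face j.succ))) :=
    fun j => by ring
  simp only [e₁, e₂]
  ring

theorem cup_mem_cocycles {p q n : ℕ} (h : p + q = n) {c : Cochain p X} {d : Cochain q X}
    (hc : c ∈ cocycles p X) (hd : d ∈ cocycles q X) : cupCochain h c d ∈ cocycles n X := by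
  have hc' : coboundary p X c = 0 := hc
  have hd' : coboundary q X d = 0 := hd
  change coboundary n X _ = 0
  rw [coboundary_cup, hc', hd']
  simp

theorem cup_mem_coboundaries_left {p q n : ℕ} (h : p + q = n) {c : Cochain p X} {d : Cochain q X}
    (hc : c ∈ coboundaries p X) (hd : d ∈ cocycles q X) :
    cupCochain h c d ∈ coboundaries n X := by
  have hd' : coboundary q X d = 0 := hd
  cases p with
  | zero =>
    have hc' : c = 0 := hc
    rw [hc', map_zero]
    exact Submodule.zero_mem _
  | succ p =>
    obtain ⟨b, rfl⟩ := hc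
    obtain ⟨m, rfl⟩ : ∃ m, n = m + 1 := ⟨p + q, by omega⟩
    refine ⟨cupCochain (by omega) b d, ?_⟩
    rw [coboundary_cup, hd']
    simp

theorem cup_mem_coboundaries_right {p q n : ℕ} (h : p + q = n) {c : Cochain p X} {d : Cochain q X}
    (hc : c ∈ cocycles p X) (hd : d ∈ coboundaries q X) :
    cupCochain h c d ∈ coboundaries n X := by
  have hc' : coboundary p X c = 0 := hc
  cases q with
  | zero =>
    have hd' : d = 0 := hd
    rw [hd', map_zero]
    exact Submodule.zero_mem _
  | succ q =>
    obtain ⟨b, rfl⟩ := hd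
    obtain ⟨m, rfl⟩ : ∃ m, n = m + 1 := ⟨p + q, by omega⟩
    refine ⟨((-1) ^ p : ℤ) • cupCochain (by omega) c b, ?_⟩
    rw [map_smul, coboundary_cup, hc', map_zero, LinearMap.zero_apply, zero_add, smul_smul,
      ← mul_pow]
    simp

/-- The cup product of cocycles, with values in cohomology. -/
def cupCocycle {p q n : ℕ} (h : p + q = n) :
    cocycles p X →ₗ[ℤ] cocycles q X →ₗ[ℤ] Cohomology n X :=
  LinearMap.mk₂ ℤ
    (fun c d => Submodule.Quotient.mk ⟨cupCochain h c.1 d.1, cup_mem_cocycles h c.2 d.2⟩)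
    (fun c c' d => congrArg Submodule.Quotient.mk (Subtype.ext (by simp)))
    (fun k c d => congrArg Submodule.Quotient.mk (Subtype.ext
      (LinearMap.map_smul₂ (cupCochain h) k c.1 d.1)))
    (fun c d d' => congrArg Submodule.Quotient.mk (Subtype.ext (by simp)))
    (fun k c d => congrArg Submodule.Quotient.mk (Subtype.ext
      ((cupCochain h c.1).map_smul k d.1)))

/-- The cup product `H^p(X) × H^q(X) → H^(p+q)(X)`. -/
def cup (p q : ℕ) : Cohomology p X →ₗ[ℤ] Cohomology q X →ₗ[ℤ] Cohomology (p + q) X :=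
  LinearMap.liftQ₂ _ _ (cupCocycle rfl)
    (fun _ hc => LinearMap.mem_ker.2 <| LinearMap.ext fun d =>
      (Submodule.Quotient.mk_eq_zero _).2 (cup_mem_coboundaries_left rfl hc d.2))
    (fun _ hd => LinearMap.mem_ker.2 <| LinearMap.ext fun c =>
      (Submodule.Quotient.mk_eq_zero _).2 (cup_mem_coboundaries_right rfl c.2 hd))

/-- The pairing `H²(X) × H²(X) → ℤ`, `(x, y) ↦ (x ∪ y) ∩ a`, of a class `a ∈ H₄(X)`. -/
def cupPairing (a : Homology 4 X) : Cohomology 2 X →ₗ[ℤ] Cohomology 2 X →ₗ[ℤ] ℤ :=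
  (cup 2 2).compr₂ ((capEval 4).flip a)

end Products

/-! ### Integral bilinear forms -/

section Forms

variable {V : Type*} [AddCommGroup V]

/-- The quotient of an abelian group by its torsion subgroup. -/
abbrev ModTorsion (V : Type*) [AddCommGroup V] : Type _ := V ⧸ Submodule.torsion ℤ V

theorem torsion_le_ker (F : V →ₗ[ℤ] V →ₗ[ℤ] ℤ) : Submodule.torsion ℤ V ≤ LinearMap.ker F := by
  rintro v ⟨⟨k, hk⟩, hv⟩
  rw [LinearMap.mem_ker]
  refine LinearMap.ext fun w => ?_
  have hkv : k • v = 0 := hv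
  have hz : k • F v w = 0 := by rw [← LinearMap.map_smul₂, hkv, map_zero, LinearMap.zero_apply]
  exact (smul_eq_zero.1 hz).resolve_left (nonZeroDivisors.ne_zero hk)

/-- An integral bilinear form on `V` induces one on `V / torsion`. -/
def formModTorsion (F : V →ₗ[ℤ] V →ₗ[ℤ] ℤ) : ModTorsion V →ₗ[ℤ] ModTorsion V →ₗ[ℤ] ℤ :=
  LinearMap.liftQ₂ _ _ F (torsion_le_ker F) (torsion_le_ker F.flip)

/-- The restriction of an integral bilinear form to a subgroup. -/
def restrictForm (F : V →ₗ[ℤ] V →ₗ[ℤ] ℤ) (W : Submodule ℤ V) : W →ₗ[ℤ] W →ₗ[ℤ] ℤ :=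
  F.compl₁₂ W.subtype W.subtype

/-- The form vanishes identically on the subgroup `W`. -/
def IsIsotropic (F : V →ₗ[ℤ] V →ₗ[ℤ] ℤ) (W : Submodule ℤ V) : Prop :=
  ∀ x ∈ W, ∀ y ∈ W, F x y = 0

/-- `F(v, v)` is even for all `v`. -/
def IsEvenForm (F : V →ₗ[ℤ] V →ₗ[ℤ] ℤ) : Prop :=
  ∀ v, Even (F v v)

/-- The extension of an integral bilinear form to `V ⊗ ℝ`. -/
def realForm (F : V →ₗ[ℤ] V →ₗ[ℤ] ℤ) : LinearMap.BilinForm ℝ (ℝ ⊗[ℤ] V) :=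
  LinearMap.BilinForm.baseChange ℝ F

/-- `b⁺(F)`: the maximal dimension of a real subspace of `V ⊗ ℝ` on which `F` is positive
definite (a supremum in `ℕ∞`, so that no finiteness has to be presupposed). -/
def bPlus (F : V →ₗ[ℤ] V →ₗ[ℤ] ℤ) : ℕ∞ :=
  ⨆ (W : Submodule ℝ (ℝ ⊗[ℤ] V)) (_ : ∀ w ∈ W, w ≠ 0 → 0 < realForm F w w),
    Cardinal.toENat (Module.rank ℝ W)

/-- `b⁻(F)`: the maximal dimension of a real subspace of `V ⊗ ℝ` on which `F` is negative
definite. -/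
def bMinus (F : V →ₗ[ℤ] V →ₗ[ℤ] ℤ) : ℕ∞ :=
  ⨆ (W : Submodule ℝ (ℝ ⊗[ℤ] V)) (_ : ∀ w ∈ W, w ≠ 0 → realForm F w w < 0),
    Cardinal.toENat (Module.rank ℝ W)

end Forms

/-! ### Eilenberg–MacLane spaces and manifolds over them -/

/-- The space `B` is a model of `B_G`: a based, connected CW complex with `π₁(B)` identified
with `G` and `π_i(B) = 0` for `i ≥ 2`. Then `H_*(G) = H_*(B)` and `H^*(G) = H^*(B)`. -/
structure EilenbergMacLane (G : Type*) [Group G] (B : Type*) [TopologicalSpace B] where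
  /-- the base point -/
  base : B
  t2 : T2Space B
  connected : ConnectedSpace B
  cw : Nonempty (Topology.CWComplex (Set.univ : Set B))
  /-- the identification of the fundamental group with `G` -/
  iso : FundamentalGroup B base ≃* G
  aspherical : ∀ i : ℕ, 2 ≤ i → Subsingleton (HomotopyGroup.Pi i B base)

/-- `c ∈ H_n(M)` is a fundamental (orientation) class of the closed `n`-manifold `M`: for every
point `x` its image generates the local homology group `H_n(M, M ∖ {x})`. -/
def IsFundamentalClass (n : ℕ) {M : Type*} [TopologicalSpace M] (c : Homology n M) : Prop :=
  ∀ x : M, Submodule.span ℤ {toRel n ({x}ᶜ : Set M) c} = ⊤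

/-- The pair `(M, φ)`, for the closed 4-manifold `M` with base point `x₀` and orientation
class `c = [M]` and an isomorphism `φ : π₁(M) → G`, lies in `𝓜(G, α)`, where `α ∈ H₄(G)` and
`f : M → B_G` is a based map inducing `φ`: the class `f_*([M])` is `α`. -/
structure MemM {G : Type*} [Group G] {B : Type*} [TopologicalSpace B] (K : EilenbergMacLane G B)
    (α : Homology 4 B) {M : Type*} [TopologicalSpace M] (c : Homology 4 M) {x₀ : M}
    (φ : FundamentalGroup M x₀ ≃* G) (f : C(M, B)) : Prop where
  orientation : IsFundamentalClass 4 c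
  based : f x₀ = K.base
  induces : ∀ γ, K.iso (FundamentalGroup.mapOfEq f based γ) = φ γ
  map_class : Homology.map 4 f c = α

section Intersection

variable {M : Type*} [TopologicalSpace M]

/-- The intersection form `(x, y) ↦ (x ∪ y) ∩ [M]` on `H²(M) / torsion`. -/
def intersectionForm (c : Homology 4 M) :
    ModTorsion (Cohomology 2 M) →ₗ[ℤ] ModTorsion (Cohomology 2 M) →ₗ[ℤ] ℤ :=
  formModTorsion (cupPairing c)

/-- The composite `H²(G) → H²(M) → H²(M) / torsion` of `f^*` and the quotient map. -/
def pullbackModTorsion {B : Type*} [TopologicalSpace B] (f : C(M, B)) :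
    Cohomology 2 B →ₗ[ℤ] ModTorsion (Cohomology 2 M) :=
  (Submodule.torsion ℤ (Cohomology 2 M)).mkQ ∘ₗ Cohomology.map 2 f

/-- `I(M, f)`, the image of `H²(G) → H²(M) → H²(M) / torsion`. -/
def imageI {B : Type*} [TopologicalSpace B] (f : C(M, B)) :
    Submodule ℤ (ModTorsion (Cohomology 2 M)) :=
  LinearMap.range (pullbackModTorsion f)

end Intersection

end GroupGeography

end

noncomputable section

namespace GroupGeography

open scoped unitInterval

/-! ### Definite subspaces and torsion for integral forms -/

section FormLemmas

variable {V : Type*} [AddCommGroup V]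

/-! Everything except injectivity of `f^*` is formal. Cup products are natural and evaluation
satisfies the projection formula, so `(f^*x ∪ f^*y) ∩ [M] = (x ∪ y) ∩ f_*[M] = (x ∪ y) ∩ α`
(`cupPairing_map`). Isotropy and evenness follow at once. The bounds on `b^±` hold because `ℝ` is
flat over `ℤ`, so `I(M, f) ⊗ ℝ` embeds in the real cohomology form. An injective `f^*` reflects
torsion, which gives the isomorphism of `H²(G) / torsion` with `I(M, f)`.

Injectivity of `f^*` on `H²` uses only that `f` is bijective on `π₁`, that `B` is path connected and
that `π₂(B) = 0`. It is proved on singular cochains (`exists_coboundary_eq`). Let `c` be a 2-cocycle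
on `B` with `f^*c = δb`. Choose paths `P y` from each `y` to `f x₀`. Surjectivity on `π₁` deforms
each edge `e : a → a'` of `B`, along `P a` and `P a'`, to the image of a loop `γ` of `M`; two
triangles `T`, `S` record the deformation. Put `b'(e) = c(T) - c(S) + b(γ)`. Over a triangle `τ` the
three loops bound a triangle of `M` by injectivity on `π₁`, and the prism between `τ` and its image
splits into three tetrahedron boundaries. Each of these is filled because `π₂(B) = 0`, so `c`
vanishes on it; the three relations and `f^*c = δb` give `δb' = c`.

Two translations support this. Triviality of `π_n`, defined by cubes modulo their boundary, must
yield fillings of simplex boundaries (`exists_closedBall_extension`,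
`Simplex.exists_of_matching_faces`). Triangles with prescribed edges must correspond to path
homotopies (`homotopic_of_faces`, `exists_simplex_of_homotopic`). -/

theorem realForm_lTensor_subtype (F : V →ₗ[ℤ] V →ₗ[ℤ] ℤ) (W : Submodule ℤ V)
    (x y : ℝ ⊗[ℤ] W) :
    realForm F (W.subtype.baseChange ℝ x) (W.subtype.baseChange ℝ y) =
      realForm (restrictForm F W) x y := by
  induction x with
  | zero => simp
  | add x₁ x₂ h₁ h₂ => simp [map_add, h₁, h₂]
  | tmul r v =>
    induction y with
    | zero => simp
    | add y₁ y₂ h₁ h₂ => simp only [map_add, h₁, h₂]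
    | tmul s w => simp [realForm, restrictForm]

theorem baseChange_subtype_injective (W : Submodule ℤ V) :
    Function.Injective (W.subtype.baseChange ℝ) :=
  Module.Flat.lTensor_preserves_injective_linearMap (M := ℝ) W.subtype W.injective_subtype

theorem toENat_rank_map (W : Submodule ℤ V) (U : Submodule ℝ (ℝ ⊗[ℤ] W)) :
    Cardinal.toENat (Module.rank ℝ (U.map (W.subtype.baseChange ℝ))) =
      Cardinal.toENat (Module.rank ℝ U) :=
  congrArg _
    (Submodule.equivMapOfInjective _ (baseChange_subtype_injective W) U).rank_eq.symm

/-- Base change of the inclusion of `W` is injective by flatness and compatible with the forms, so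
it carries a definite subspace to a definite subspace of the same rank. -/
theorem bPlus_restrictForm_le (F : V →ₗ[ℤ] V →ₗ[ℤ] ℤ) (W : Submodule ℤ V) :
    bPlus (restrictForm F W) ≤ bPlus F := by
  refine iSup₂_le fun U hU => ?_
  rw [← toENat_rank_map W U]
  refine le_iSup₂_of_le (U.map (W.subtype.baseChange ℝ)) ?_ le_rfl
  rintro _ ⟨u, hu, rfl⟩ hne
  rw [realForm_lTensor_subtype]
  exact hU u hu fun h => hne (by rw [h, map_zero])

theorem bMinus_restrictForm_le (F : V →ₗ[ℤ] V →ₗ[ℤ] ℤ) (W : Submodule ℤ V) :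
    bMinus (restrictForm F W) ≤ bMinus F := by
  refine iSup₂_le fun U hU => ?_
  rw [← toENat_rank_map W U]
  refine le_iSup₂_of_le (U.map (W.subtype.baseChange ℝ)) ?_ le_rfl
  rintro _ ⟨u, hu, rfl⟩ hne
  rw [realForm_lTensor_subtype]
  exact hU u hu fun h => hne (by rw [h, map_zero])

/-- The kernel of an injective map followed by the quotient by torsion is the torsion. -/
theorem ker_mkQ_torsion_comp {U : Type*} [AddCommGroup U] {g : U →ₗ[ℤ] V}
    (hg : Function.Injective g) :
    LinearMap.ker ((Submodule.torsion ℤ V).mkQ ∘ₗ g) = Submodule.torsion ℤ U := by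
  ext x
  rw [LinearMap.mem_ker, LinearMap.comp_apply, Submodule.mkQ_apply,
    Submodule.Quotient.mk_eq_zero]
  refine exists_congr fun a => ?_
  change (a : ℤ) • g x = 0 ↔ (a : ℤ) • x = 0
  rw [← map_smul, map_eq_zero_iff g hg]

end FormLemmas

/-! ### Naturality of evaluation, cup product and intersection form -/

section Naturality

variable {X Y : Type*} [TopologicalSpace X] [TopologicalSpace Y]

theorem evalChain_cochainMap (n : ℕ) (f : C(X, Y)) (c : Cochain n Y) (d : Chain n X) :
    evalChain (cochainMap n f c) d = evalChain c (chainMap n f d) := by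
  suffices h : evalChain (cochainMap n f c) = evalChain c ∘ₗ chainMap n f from
    LinearMap.congr_fun h d
  refine Finsupp.lhom_ext fun s k => ?_
  simp [evalChain, chainMap, cochainMap, LinearMap.funLeft]

theorem capEval_map (n : ℕ) (f : C(X, Y)) (x : Cohomology n Y) (a : Homology n X) :
    capEval n (Cohomology.map n f x) a = capEval n x (Homology.map n f a) := by
  obtain ⟨c, rfl⟩ := Submodule.Quotient.mk_surjective _ x
  obtain ⟨d, rfl⟩ := Submodule.Quotient.mk_surjective _ a
  exact evalChain_cochainMap n f c.1 d.1

theorem cup_map (p q : ℕ) (f : C(X, Y)) (x : Cohomology p Y) (y : Cohomology q Y) :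
    cup p q (Cohomology.map p f x) (Cohomology.map q f y) =
      Cohomology.map (p + q) f (cup p q x y) := by
  obtain ⟨c, rfl⟩ := Submodule.Quotient.mk_surjective _ x
  obtain ⟨d, rfl⟩ := Submodule.Quotient.mk_surjective _ y
  rfl

/-- Naturality of the cup product combined with the projection formula: on pulled-back classes the
pairing sees `a` only through its image in `H₄(Y)`. -/
theorem cupPairing_map (f : C(X, Y)) (a : Homology 4 X) (x y : Cohomology 2 Y) :
    cupPairing a (Cohomology.map 2 f x) (Cohomology.map 2 f y) =
      cupPairing (Homology.map 4 f a) x y := by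
  change capEval 4 (cup 2 2 _ _) a = capEval 4 (cup 2 2 x y) _
  rw [cup_map, capEval_map]

theorem intersectionForm_pullbackModTorsion (f : C(X, Y)) (a : Homology 4 X)
    (x y : Cohomology 2 Y) :
    intersectionForm a (pullbackModTorsion f x) (pullbackModTorsion f y) =
      cupPairing (Homology.map 4 f a) x y :=
  cupPairing_map f a x y

/-- If `f^*` is injective on `H²`, it identifies `H²(Y) / torsion` with `I(X, f)`. -/
def modTorsionEquivImageI (f : C(X, Y)) (hf : Function.Injective (Cohomology.map 2 f)) :
    ModTorsion (Cohomology 2 Y) ≃ₗ[ℤ] imageI f :=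
  (Submodule.quotEquivOfEq _ _ (ker_mkQ_torsion_comp hf).symm).trans
    (pullbackModTorsion f).quotKerEquivRange

theorem coe_modTorsionEquivImageI_mk (f : C(X, Y))
    (hf : Function.Injective (Cohomology.map 2 f)) (x : Cohomology 2 Y) :
    (modTorsionEquivImageI f hf (Submodule.Quotient.mk x) : ModTorsion (Cohomology 2 X)) =
      pullbackModTorsion f x :=
  rfl

end Naturality

open Set Metric

/-! ### Connected CW complexes are path connected -/

section CWComplex

variable {B : Type*} [TopologicalSpace B]

/-- Closed cells are path connected, so a union of path components meets each of them in everything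
or nothing, and closedness is tested on closed cells. Applied to a path component and to its
complement, this makes path components clopen. -/
theorem isClosed_of_joined_of_cwComplex [T2Space B] [Topology.CWComplex (univ : Set B)]
    {A : Set B} (hA : ∀ y ∈ A, ∀ z, Joined y z → z ∈ A) : IsClosed A := by
  rw [Topology.CWComplex.closed univ A (subset_univ A)]
  intro n j
  by_cases hne : (A ∩ Topology.RelCWComplex.closedCell n j).Nonempty
  · obtain ⟨y, hyA, hy⟩ := hne
    have hpath : IsPathConnected (Topology.RelCWComplex.closedCell (C := (univ : Set B)) n j) :=
      ((convex_closedBall (0 : Fin n → ℝ) 1).isPathConnected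
        ⟨0, mem_closedBall_self zero_le_one⟩).image' (Topology.RelCWComplex.continuousOn n j)
    have hsub : Topology.RelCWComplex.closedCell n j ⊆ A := fun z hz =>
      hA y hyA z (hpath.joinedIn y hy z hz).joined
    rw [inter_eq_right.2 hsub]
    exact Topology.RelCWComplex.isClosed_closedCell
  · rw [not_nonempty_iff_eq_empty.1 hne]
    exact isClosed_empty

theorem pathConnectedSpace_of_cwComplex [T2Space B] [ConnectedSpace B]
    [Topology.CWComplex (univ : Set B)] : PathConnectedSpace B := by
  refine ⟨inferInstance, fun x y => ?_⟩
  have hclopen : IsClopen (pathComponent x) := by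
    refine ⟨isClosed_of_joined_of_cwComplex fun y hy z hyz => hy.trans hyz, ?_⟩
    rw [← isClosed_compl_iff]
    exact isClosed_of_joined_of_cwComplex fun y hy z hyz hz => hy (Joined.trans hz hyz.symm)
  have huniv := hclopen.eq_univ ⟨x, mem_pathComponent_self x⟩
  exact (huniv.ge (mem_univ y) : y ∈ pathComponent x)

end CWComplex

/-! ### The sphere as a ball with collapsed boundary -/

section Sphere

variable {F : Type*} [NormedAddCommGroup F] [InnerProductSpace ℝ F]

/-- The map from the unit ball of `vᗮ` to the unit sphere which collapses the boundary of the ball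
to `v`. -/
def ballToSphere (v x : F) : F := (2 * √(1 - ‖x‖ ^ 2)) • x + (2 * ‖x‖ ^ 2 - 1) • v

theorem continuous_ballToSphere (v : F) : Continuous (ballToSphere v) := by
  unfold ballToSphere
  fun_prop

theorem ballToSphere_of_norm_eq_one (v : F) {x : F} (hx : ‖x‖ = 1) : ballToSphere v x = v := by
  norm_num [ballToSphere, hx]

/-- With `r = ‖x‖` and `x` orthogonal to `v`, this is `4 r² (1 - r²) + (2 r² - 1)² = 1`. -/
theorem norm_ballToSphere {v x : F} (hv : ‖v‖ = 1) (hvx : inner ℝ v x = 0) (hx : ‖x‖ ≤ 1) :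
    ‖ballToSphere v x‖ = 1 := by
  have hsq : ‖ballToSphere v x‖ ^ 2 = 1 := by
    have h1 : 0 ≤ 1 - ‖x‖ ^ 2 := by nlinarith [norm_nonneg x]
    rw [ballToSphere, norm_add_sq_real, norm_smul, norm_smul, inner_smul_left, inner_smul_right,
      real_inner_comm, hvx, hv, mul_pow, Real.norm_eq_abs, sq_abs, mul_pow, mul_pow, Real.sq_sqrt h1,
      Real.norm_eq_abs, sq_abs]
    ring
  exact (pow_eq_one_iff_of_nonneg (norm_nonneg _) two_ne_zero).1 hsq

theorem inner_ballToSphere {v x : F} (hv : ‖v‖ = 1) (hvx : inner ℝ v x = 0) :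
    inner ℝ v (ballToSphere v x) = 2 * ‖x‖ ^ 2 - 1 := by
  simp [ballToSphere, inner_add_right, inner_smul_right, hvx, hv]

/-- The height `2 ‖x‖² - 1` along `v` determines `‖x‖`; below norm one the coefficient of the
horizontal part is nonzero, so `x` is determined as well. -/
theorem eq_of_ballToSphere_eq {v x y : F} (hv : ‖v‖ = 1) (hvx : inner ℝ v x = 0)
    (hvy : inner ℝ v y = 0) (hx : ‖x‖ ≤ 1) (h : ballToSphere v x = ballToSphere v y) :
    x = y ∨ ‖x‖ = 1 ∧ ‖y‖ = 1 := by
  have hnorm : ‖x‖ = ‖y‖ := by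
    have := congrArg (inner ℝ v) h
    rw [inner_ballToSphere hv hvx, inner_ballToSphere hv hvy] at this
    exact (pow_left_inj₀ (norm_nonneg _) (norm_nonneg _) two_ne_zero).1 (by linarith)
  rcases hx.eq_or_lt with h1 | h1
  · exact Or.inr ⟨h1, hnorm ▸ h1⟩
  · left
    have hpos : 0 < 1 - ‖y‖ ^ 2 := by rw [← hnorm]; nlinarith [norm_nonneg x]
    rw [ballToSphere, ballToSphere, hnorm, add_left_inj] at h
    exact (smul_right_injective F (mul_pos two_pos (Real.sqrt_pos.2 hpos)).ne') h

/-- The vector `e` serves only as a preimage of the pole `v`, onto which the whole boundary of the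
ball is collapsed. -/
theorem exists_ballToSphere_eq {v y e : F} (hv : ‖v‖ = 1) (hy : ‖y‖ = 1)
    (he : inner ℝ v e = 0) (he' : ‖e‖ = 1) :
    ∃ x, inner ℝ v x = 0 ∧ ‖x‖ ≤ 1 ∧ ballToSphere v x = y := by
  obtain ⟨z, hz⟩ : ∃ z, z = inner ℝ v y := ⟨_, rfl⟩
  obtain ⟨w, hw⟩ : ∃ w, w = y - z • v := ⟨_, rfl⟩
  have hvw : inner ℝ v w = 0 := by
    rw [hw, inner_sub_right, inner_smul_right, real_inner_self_eq_norm_sq, hv, hz]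
    ring
  have hyw : y = w + z • v := by rw [hw, sub_add_cancel]
  have hsum : ‖w‖ ^ 2 + z ^ 2 = 1 := by
    have h : ‖y‖ ^ 2 = 1 := by rw [hy, one_pow]
    rw [hyw, norm_add_sq_real, inner_smul_right, real_inner_comm, hvw, norm_smul, mul_pow, hv,
      Real.norm_eq_abs, sq_abs] at h
    linarith
  have hz1 : z ≤ 1 := by nlinarith [sq_nonneg ‖w‖]
  rcases hz1.eq_or_lt with rfl | hz1
  · have hw0 : w = 0 := by
      have : ‖w‖ ^ 2 = 0 := by linarith
      simpa using this
    refine ⟨e, he, he'.le, ?_⟩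
    rw [ballToSphere_of_norm_eq_one v he', hyw, hw0, one_smul, zero_add]
  -- The height forces `‖x‖² = (1 + z) / 2`, so the horizontal coefficient must be `2 √((1 - z) /
  -- 2)`; dividing `w` by it gives `x`.
  · have hpos : 0 < (1 - z) / 2 := by linarith
    have hr : 0 < 2 * √((1 - z) / 2) := mul_pos two_pos (Real.sqrt_pos.2 hpos)
    have hnorm : ‖(2 * √((1 - z) / 2))⁻¹ • w‖ ^ 2 = (1 + z) / 2 := by
      rw [norm_smul, mul_pow, Real.norm_eq_abs, sq_abs, inv_pow, mul_pow, Real.sq_sqrt hpos.le]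
      have : ‖w‖ ^ 2 = (1 - z) * (1 + z) := by linarith
      rw [this]
      have : (1 - z) ≠ 0 := by linarith
      field_simp
    refine ⟨(2 * √((1 - z) / 2))⁻¹ • w, ?_, ?_, ?_⟩
    · rw [inner_smul_right, hvw, mul_zero]
    · exact (sq_le_one_iff₀ (norm_nonneg _)).1 (by rw [hnorm]; linarith)
    · rw [ballToSphere, hnorm, show 1 - (1 + z) / 2 = (1 - z) / 2 by ring, smul_inv_smul₀ hr.ne',
        hyw]
      congr 2
      ring

end Sphere

/-! ### The cube is a ball -/

section CubeBall

/-- The cube is a compact convex body with nonempty interior, and a homeomorphism of the ambient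
space takes such a body to the unit ball and its interior to the open ball. -/
theorem exists_cube_ball_parametrization (n : ℕ) :
    ∃ κ : (Fin n → I) → EuclideanSpace ℝ (Fin n), Continuous κ ∧ Function.Injective κ ∧
      range κ = closedBall 0 1 ∧ ∀ z, ‖κ z‖ = 1 ↔ z ∈ Cube.boundary (Fin n) := by
  let L : EuclideanSpace ℝ (Fin n) ≃L[ℝ] (Fin n → ℝ) := EuclideanSpace.equiv (Fin n) ℝ
  let s : Set (EuclideanSpace ℝ (Fin n)) := L ⁻¹' univ.pi fun _ => Icc 0 1
  have hint : interior s = L ⁻¹' univ.pi fun _ => Ioo 0 1 := by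
    have := L.toHomeomorph.preimage_interior (univ.pi fun _ => Icc (0 : ℝ) 1)
    rw [interior_pi_set finite_univ] at this
    simp only [interior_Icc] at this
    exact this.symm
  have hconv : Convex ℝ s :=
    (convex_pi fun _ _ => convex_Icc (0 : ℝ) 1).linear_preimage L.toLinearEquiv.toLinearMap
  have hne : (interior s).Nonempty := by
    rw [hint]
    refine ⟨L.symm fun _ => 1 / 2, ?_⟩
    rw [mem_preimage, L.apply_symm_apply]
    intro i _
    norm_num
  have hcpt : IsCompact s :=
    L.toHomeomorph.isCompact_preimage.2 (isCompact_univ_pi fun _ => isCompact_Icc)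
  obtain ⟨h, hi, hc, hf⟩ :=
    exists_homeomorph_image_interior_closure_frontier_eq_unitBall hconv hne hcpt.isBounded
  rw [hcpt.isClosed.closure_eq] at hc
  have hmem : ∀ z : Fin n → I, L.symm (fun i => (z i : ℝ)) ∈ s := by
    intro z
    rw [mem_preimage, L.apply_symm_apply]
    exact fun i _ => (z i).2
  refine ⟨fun z => h (L.symm fun i => z i), by fun_prop, ?_, ?_, ?_⟩
  · intro z w hzw
    funext i
    exact Subtype.ext (congrFun (L.symm.injective (h.injective hzw)) i)
  · rw [← hc]
    ext y
    constructor
    · rintro ⟨z, rfl⟩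
      exact ⟨_, hmem z, rfl⟩
    · rintro ⟨x, hx, rfl⟩
      refine ⟨fun i => ⟨L x i, hx i (mem_univ i)⟩, ?_⟩
      change h (L.symm (L x)) = h x
      rw [L.symm_apply_apply]
  · intro z
    have hball : h (L.symm fun i => (z i : ℝ)) ∈ closedBall 0 1 := hc ▸ ⟨_, hmem z, rfl⟩
    have hiff : h (L.symm fun i => (z i : ℝ)) ∈ ball 0 1 ↔ ∀ i, 0 < z i ∧ z i < 1 := by
      rw [← hi, h.injective.mem_set_image, hint, mem_preimage, L.apply_symm_apply]
      simp [mem_pi]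
    rw [mem_closedBall_zero_iff] at hball
    rw [mem_ball_zero_iff] at hiff
    rw [← hball.not_lt_iff_eq, hiff]
    simp only [not_forall, Cube.boundary, mem_ofPred_eq]
    refine exists_congr fun i => ?_
    rw [not_and_or, not_lt, not_lt]
    exact or_congr ⟨fun h => le_antisymm h unitInterval.nonneg', fun h => h.le⟩
      ⟨fun h => le_antisymm unitInterval.le_one' h, fun h => h.ge⟩

end CubeBall

/-! ### Filling spheres and simplex boundaries when a homotopy group vanishes -/

section Filling

variable {B : Type*} [TopologicalSpace B]

/-- If `π_n(B, b) = 0`, a map from the unit sphere of an `(n + 1)`-dimensional Euclidean space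
taking the value `b` extends to the unit ball. -/
theorem exists_closedBall_extension {F : Type*} [NormedAddCommGroup F] [InnerProductSpace ℝ F]
    {n : ℕ} [NeZero n] [Fact (Module.finrank ℝ F = n + 1)] {b : B}
    (hB : Subsingleton (HomotopyGroup.Pi n B b)) (u : C(sphere (0 : F) 1, B))
    (v : sphere (0 : F) 1) (huv : u v = b) :
    ∃ U : C(closedBall (0 : F) 1, B), ∀ z : sphere (0 : F) 1,
      U ⟨z, sphere_subset_closedBall z.2⟩ = u z := by
  have hv : ‖(v : F)‖ = 1 := norm_eq_of_mem_sphere v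
  obtain ⟨κ, hκc, hκi, hκr, hκb⟩ := exists_cube_ball_parametrization n
  let ℓ := (OrthonormalBasis.fromOrthogonalSpanSingleton (𝕜 := ℝ) n
    (norm_ne_zero_iff.1 (hv.trans_ne one_ne_zero))).repr.symm
  have hℓ : ∀ x, inner ℝ (v : F) (ℓ x : F) = 0 := fun x =>
    Submodule.mem_orthogonal_singleton_iff_inner_right.1 (ℓ x).2
  have hℓn : ∀ x, ‖(ℓ x : F)‖ = ‖x‖ := fun x => ℓ.norm_map x
  have hκ1 : ∀ z, ‖κ z‖ ≤ 1 := fun z =>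
    mem_closedBall_zero_iff.1 (hκr ▸ mem_range_self z)
  have hq1 : ∀ z, ‖ballToSphere (v : F) (ℓ (κ z))‖ = 1 := fun z =>
    norm_ballToSphere hv (hℓ _) ((hℓn _).trans_le (hκ1 z))
  -- `q` exhibits the sphere as the cube with its boundary collapsed to `v`, so that `u ∘ q` is a
  -- generalized loop at `b`.
  let q : C(Fin n → I, sphere (0 : F) 1) :=
    ⟨fun z => ⟨ballToSphere (v : F) (ℓ (κ z)), mem_sphere_zero_iff_norm.2 (hq1 z)⟩,
      ((continuous_ballToSphere _).comp (continuous_subtype_val.comp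
        (ℓ.continuous.comp hκc))).subtype_mk _⟩
  have hqb : ∀ z ∈ Cube.boundary (Fin n), q z = v := fun z hz =>
    Subtype.ext (ballToSphere_of_norm_eq_one _ ((hℓn _).trans ((hκb z).2 hz)))
  have hqi : ∀ z w, q z = q w → z = w ∨ z ∈ Cube.boundary (Fin n) ∧ w ∈ Cube.boundary (Fin n) := by
    intro z w h
    rcases eq_of_ballToSphere_eq hv (hℓ _) (hℓ _) ((hℓn _).trans_le (hκ1 z))
      (congrArg Subtype.val h) with h | ⟨h, h'⟩
    · exact Or.inl (hκi (ℓ.injective (Subtype.ext h)))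
    · exact Or.inr ⟨(hκb z).1 ((hℓn _).symm.trans h), (hκb w).1 ((hℓn _).symm.trans h')⟩
  have hqs : Function.Surjective q := by
    intro y
    -- Here `n ≠ 0` matters: the cube must have a boundary point to hit the pole.
    obtain ⟨z₀, hz₀⟩ : ∃ z₀, z₀ ∈ Cube.boundary (Fin n) := ⟨fun _ => 0, 0, Or.inl rfl⟩
    obtain ⟨x, hx, hx1, hxy⟩ := exists_ballToSphere_eq hv (norm_eq_of_mem_sphere y)
      (hℓ (κ z₀)) ((hℓn _).trans ((hκb z₀).2 hz₀))
    obtain ⟨x', hx'⟩ := ℓ.surjective ⟨x, Submodule.mem_orthogonal_singleton_iff_inner_right.2 hx⟩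
    have hx'x : (ℓ x' : F) = x := congrArg Subtype.val hx'
    have hmem : x' ∈ range κ := by
      rw [hκr, mem_closedBall_zero_iff, ← hℓn, hx'x]
      exact hx1
    obtain ⟨z, rfl⟩ := hmem
    exact ⟨z, Subtype.ext (by change ballToSphere (v : F) (ℓ (κ z)) = y; rw [hx'x, hxy])⟩
  let g : GenLoop (Fin n) B b := ⟨u.comp q, fun z hz => by
    rw [ContinuousMap.comp_apply, hqb z hz, huv]⟩
  obtain ⟨H⟩ : GenLoop.Homotopic g GenLoop.const :=
    Quotient.exact (hB.elim (Quotient.mk _ g) (Quotient.mk _ GenLoop.const))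
  have hH1 : ∀ z, H (1, z) = b := fun z => H.apply_one z
  have hH0 : ∀ z, H (0, z) = u (q z) := fun z => H.apply_zero z
  have hHb : ∀ t, ∀ z ∈ Cube.boundary (Fin n), H (t, z) = b := fun t z hz =>
    (H.eq_fst t hz).trans (by change u (q z) = b; rw [hqb z hz, huv])
  have hΦ : ∀ p : I × (Fin n → I), ‖(1 - (p.1 : ℝ)) • (q p.2 : F)‖ = 1 - p.1 := by
    intro p
    rw [norm_smul, norm_eq_of_mem_sphere, mul_one, Real.norm_of_nonneg (sub_nonneg.2 p.1.2.2)]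
  -- Polar coordinates: time `0` is the sphere and time `1` the centre. The null homotopy `H` is to
  -- descend along `Φ` to the ball.
  let Φ : C(I × (Fin n → I), closedBall (0 : F) 1) :=
    ⟨fun p => ⟨(1 - (p.1 : ℝ)) • (q p.2 : F), mem_closedBall_zero_iff.2
      ((hΦ p).trans_le (sub_le_self _ p.1.2.1))⟩, by fun_prop⟩
  have hΦs : Function.Surjective Φ := by
    rintro ⟨y, hy⟩
    rw [mem_closedBall_zero_iff] at hy
    obtain ⟨y', hy'⟩ : ∃ y' : sphere (0 : F) 1, ‖y‖ • (y' : F) = y := by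
      by_cases h : y = 0
      · exact ⟨v, by rw [h, norm_zero, zero_smul]⟩
      · refine ⟨⟨‖y‖⁻¹ • y, mem_sphere_zero_iff_norm.2 ?_⟩, ?_⟩
        · rw [norm_smul, norm_inv, norm_norm, inv_mul_cancel₀ (norm_ne_zero_iff.2 h)]
        · exact smul_inv_smul₀ (norm_ne_zero_iff.2 h) y
    obtain ⟨z, rfl⟩ := hqs y'
    refine ⟨(⟨1 - ‖y‖, sub_nonneg.2 hy, sub_le_self _ (norm_nonneg y)⟩, z), Subtype.ext ?_⟩
    change (1 - (1 - ‖y‖)) • (q z : F) = y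
    rw [sub_sub_cancel, hy']
  -- The norm recovers `t`. At `t = 1` everything goes to the centre, where `H` is `b`; for `t < 1`
  -- the only identifications are between boundary points of the cube, where `H` is again `b`.
  have hfac : Function.FactorsThrough H.toContinuousMap Φ := by
    rintro ⟨t, z⟩ ⟨t', w⟩ h
    change H (t, z) = H (t', w)
    have h' : (1 - (t : ℝ)) • (q z : F) = (1 - (t' : ℝ)) • (q w : F) := congrArg Subtype.val h
    have ht : (1 - (t : ℝ)) = 1 - t' := by
      rw [← hΦ (t, z), ← hΦ (t', w)]
      exact congrArg norm h'
    obtain rfl : t = t' := Subtype.ext (by linarith)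
    by_cases ht1 : t = 1
    · rw [ht1, hH1, hH1]
    · have hne : (1 - (t : ℝ)) ≠ 0 := fun h0 => ht1 (Subtype.ext (sub_eq_zero.1 h0).symm)
      rcases hqi z w (Subtype.ext (smul_right_injective F hne h')) with rfl | ⟨hz, hw⟩
      · rfl
      · rw [hHb t z hz, hHb t w hw]
  have hquot : Topology.IsQuotientMap Φ := Φ.continuous.isClosedMap.isQuotientMap Φ.continuous hΦs
  refine ⟨hquot.lift H.toContinuousMap hfac, fun y => ?_⟩
  obtain ⟨z, rfl⟩ := hqs y
  have hval : Φ (0, z) = ⟨q z, sphere_subset_closedBall (q z).2⟩ :=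
    Subtype.ext (by change (1 - ((0 : I) : ℝ)) • (q z : F) = q z; simp)
  rw [← hval, ← hH0]
  exact DFunLike.congr_fun (hquot.lift_comp H.toContinuousMap hfac) (0, z)

/-- The boundary of the standard simplex is a sphere. -/
theorem exists_stdSimplex_ball_homeomorph (n : ℕ) :
    ∃ Θ : stdSimplex ℝ (Fin (n + 1)) ≃ₜ closedBall (0 : EuclideanSpace ℝ (Fin n)) 1,
      ∀ x, ‖(Θ x : EuclideanSpace ℝ (Fin n))‖ = 1 ↔ ∃ i, x i = 0 := by
  obtain ⟨β⟩ := AffineBasis.exists_affineBasis_of_finiteDimensional (ι := Fin (n + 1)) (k := ℝ)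
    (P := EuclideanSpace ℝ (Fin n)) (by simp)
  let s := convexHull ℝ (range β)
  have hs : s = {x | ∀ i, 0 ≤ β.coord i x} := β.convexHull_eq_nonneg_coord
  have hint : interior s = {x | ∀ i, 0 < β.coord i x} := β.interior_convexHull
  have hcpt : IsCompact s := (finite_range β).isCompact_convexHull ℝ
  obtain ⟨h, hi, hc, hf⟩ := exists_homeomorph_image_interior_closure_frontier_eq_unitBall
    (convex_convexHull ℝ (range β)) ⟨_, β.centroid_mem_interior_convexHull⟩ hcpt.isBounded
  rw [hcpt.isClosed.closure_eq] at hc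
  -- `T` reads barycentric coordinates in the affine basis `β`. The interior of the convex hull is
  -- where all coordinates are positive, so norm one means that some coordinate vanishes.
  let T : stdSimplex ℝ (Fin (n + 1)) → EuclideanSpace ℝ (Fin n) := fun x => ∑ i, x i • β i
  have hT : ∀ x i, β.coord i (T x) = x i := by
    intro x i
    have := β.coord_apply_combination_of_mem (Finset.mem_univ i) (w := x) (by simp)
    rwa [Finset.affineCombination_eq_linear_combination _ _ _ (by simp)] at this
  have hTs : ∀ x, T x ∈ s := fun x => by
    rw [hs]
    intro i
    rw [hT]
    exact stdSimplex.zero_le x i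
  have hTsurj : ∀ y ∈ s, ∃ x, T x = y := by
    intro y hy
    rw [hs] at hy
    exact ⟨⟨fun i => β.coord i y, hy, β.sum_coord_apply_eq_one y⟩,
      β.linear_combination_coord_eq_self y⟩
  have hTc : Continuous T := by
    refine continuous_finsetSum _ fun i _ => ?_
    have hi : Continuous fun x : stdSimplex ℝ (Fin (n + 1)) => x i :=
      (continuous_apply i).comp continuous_subtype_val
    exact hi.smul continuous_const
  let Θ₀ : stdSimplex ℝ (Fin (n + 1)) → closedBall (0 : EuclideanSpace ℝ (Fin n)) 1 :=
    fun x => ⟨h (T x), hc ▸ mem_image_of_mem h (hTs x)⟩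
  have hΘc : Continuous Θ₀ := (h.continuous.comp hTc).subtype_mk _
  have hΘb : Function.Bijective Θ₀ := by
    constructor
    · intro x y hxy
      have hxy' : T x = T y := h.injective (congrArg Subtype.val hxy)
      refine stdSimplex.ext (funext fun i => ?_)
      rw [← hT, hxy', hT]
    · rintro ⟨y, hy⟩
      rw [← hc] at hy
      obtain ⟨z, hz, rfl⟩ := hy
      obtain ⟨x, rfl⟩ := hTsurj z hz
      exact ⟨x, rfl⟩
  refine ⟨(Equiv.ofBijective Θ₀ hΘb).toHomeomorphOfIsInducing
    (hΘc.isClosedEmbedding hΘb.1).isInducing, fun x => ?_⟩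
  change ‖h (T x)‖ = 1 ↔ _
  have hball : ‖h (T x)‖ ≤ 1 := mem_closedBall_zero_iff.1 (Θ₀ x).2
  rw [← hball.not_lt_iff_eq, ← mem_ball_zero_iff, ← hi, h.injective.mem_set_image, hint]
  simp only [mem_ofPred_eq, hT, not_forall, not_lt]
  exact exists_congr fun i => ⟨fun h => le_antisymm h (stdSimplex.zero_le x i), fun h => h.le⟩

/-- If `π_n(B, b) = 0`, a map from the boundary of the `(n + 1)`-simplex taking the value `b`
extends to the simplex. -/
theorem exists_stdSimplex_extension {n : ℕ} [NeZero n] {b : B}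
    (hB : Subsingleton (HomotopyGroup.Pi n B b))
    (u : C({x : stdSimplex ℝ (Fin (n + 2)) // ∃ i, x i = 0}, B))
    (v : {x : stdSimplex ℝ (Fin (n + 2)) // ∃ i, x i = 0}) (huv : u v = b) :
    ∃ U : C(stdSimplex ℝ (Fin (n + 2)), B), ∀ x, U x.1 = u x := by
  obtain ⟨Θ, hΘ⟩ := exists_stdSimplex_ball_homeomorph (n + 1)
  have : Fact (Module.finrank ℝ (EuclideanSpace ℝ (Fin (n + 1))) = n + 1) := ⟨by simp⟩
  have hback : ∀ z : sphere (0 : EuclideanSpace ℝ (Fin (n + 1))) 1,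
      ∃ i, Θ.symm ⟨z, sphere_subset_closedBall z.2⟩ i = 0 := by
    intro z
    rw [← hΘ, Θ.apply_symm_apply]
    exact norm_eq_of_mem_sphere z
  let u' : C(sphere (0 : EuclideanSpace ℝ (Fin (n + 1))) 1, B) :=
    u.comp ⟨fun z => ⟨Θ.symm ⟨z, sphere_subset_closedBall z.2⟩, hback z⟩, by fun_prop⟩
  have hu' : ∀ (x : {x : stdSimplex ℝ (Fin (n + 2)) // ∃ i, x i = 0}),
      u' ⟨Θ x.1, mem_sphere_zero_iff_norm.2 ((hΘ x.1).2 x.2)⟩ = u x := by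
    intro x
    refine congrArg u (Subtype.ext ?_)
    exact Θ.symm_apply_apply x.1
  obtain ⟨U, hU⟩ := exists_closedBall_extension hB u' _ ((hu' v).trans huv)
  exact ⟨U.comp ⟨Θ, Θ.continuous⟩, fun x => (hU ⟨Θ x.1, _⟩).trans (hu' x)⟩

end Filling

/-! ### Gluing simplices along matching faces -/

section Simplices

variable {X : Type*} [TopologicalSpace X]

theorem stdSimplex_map_apply_of_injective {m n : ℕ} {v : Fin m → Fin n}
    (hv : Function.Injective v) (x : stdSimplex ℝ (Fin m)) (k : Fin m) :
    stdSimplex.map v x (v k) = x k := by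
  rw [stdSimplex.map_coe, FunOnFinite.linearMap_apply_apply]
  simp [hv.eq_iff, Finset.sum_filter]

theorem stdSimplex_map_apply_of_notMem_range {m n : ℕ} {v : Fin m → Fin n}
    (x : stdSimplex ℝ (Fin m)) {j : Fin n} (hj : j ∉ range v) :
    stdSimplex.map v x j = 0 := by
  rw [stdSimplex.map_coe, FunOnFinite.linearMap_apply_apply]
  refine Finset.sum_eq_zero fun i hi => ?_
  exact (hj ⟨i, (Finset.mem_filter.1 hi).2⟩).elim

theorem stdSimplex_map_succAbove_self {n : ℕ} (i : Fin (n + 1)) (x : stdSimplex ℝ (Fin n)) :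
    stdSimplex.map i.succAbove x i = 0 :=
  stdSimplex_map_apply_of_notMem_range x (by simp)

/-- A point of the `i`-th face of the standard simplex, seen in that face. -/
def stdSimplexDrop {n : ℕ} (i : Fin (n + 1)) (x : stdSimplex ℝ (Fin (n + 1))) (hx : x i = 0) :
    stdSimplex ℝ (Fin n) :=
  ⟨fun k => x (i.succAbove k), fun k => stdSimplex.zero_le x _, by
    have := stdSimplex.sum_eq_one x
    rwa [Fin.sum_univ_succAbove _ i, hx, zero_add] at this⟩

theorem stdSimplexDrop_apply {n : ℕ} (i : Fin (n + 1)) (x : stdSimplex ℝ (Fin (n + 1)))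
    (hx : x i = 0) (k : Fin n) : stdSimplexDrop i x hx k = x (i.succAbove k) :=
  rfl

theorem map_stdSimplexDrop {n : ℕ} (i : Fin (n + 1)) (x : stdSimplex ℝ (Fin (n + 1)))
    (hx : x i = 0) : stdSimplex.map i.succAbove (stdSimplexDrop i x hx) = x := by
  refine stdSimplex.ext (funext fun j => ?_)
  rcases Fin.eq_self_or_eq_succAbove i j with rfl | ⟨k, rfl⟩
  · rw [stdSimplex_map_succAbove_self, hx]
  · rw [stdSimplex_map_apply_of_injective Fin.succAbove_right_injective, stdSimplexDrop_apply]

theorem stdSimplexDrop_map {n : ℕ} (i : Fin (n + 1)) (x : stdSimplex ℝ (Fin n)) :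
    stdSimplexDrop i (stdSimplex.map i.succAbove x) (stdSimplex_map_succAbove_self i x) = x := by
  refine stdSimplex.ext (funext fun j => ?_)
  rw [stdSimplexDrop_apply, stdSimplex_map_apply_of_injective Fin.succAbove_right_injective]

/-- The cosimplicial identity between coface maps. -/
theorem succ_succAbove_succAbove {n : ℕ} {i j : Fin (n + 1)} (hij : i ≤ j) (k : Fin n) :
    j.succ.succAbove (i.succAbove k) = i.castSucc.succAbove (j.succAbove k) := by
  apply Fin.ext
  rw [Fin.le_def] at hij
  simp only [Fin.succAbove, Fin.lt_def, Fin.val_castSucc, Fin.val_succ]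
  split_ifs <;> simp only [Fin.val_castSucc, Fin.val_succ] at * <;> omega

theorem Simplex.face_apply {n : ℕ} (i : Fin (n + 2)) (s : Simplex (n + 1) X)
    (x : stdSimplex ℝ (Fin (n + 1))) : s.face i x = s (stdSimplex.map i.succAbove x) :=
  rfl

/-- A point on two faces `i < j` lies on their common face of codimension two. Dropping both
coordinates, in either order, gives the same point there, and the matching condition compares the
two values. -/
theorem Simplex.apply_drop_eq {n : ℕ} {s : Fin (n + 3) → Simplex (n + 1) X}
    (hs : ∀ i j : Fin (n + 2), i ≤ j → (s i.castSucc).face j = (s j.succ).face i)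
    (x : stdSimplex ℝ (Fin (n + 3))) {i j : Fin (n + 3)} (hi : x i = 0) (hj : x j = 0) :
    s i (stdSimplexDrop i x hi) = s j (stdSimplexDrop j x hj) := by
  wlog hij : i < j generalizing i j
  · rcases (not_lt.1 hij).eq_or_lt with rfl | h
    · rfl
    · exact (this hj hi h).symm
  obtain ⟨i, rfl⟩ := Fin.exists_castSucc_eq.2 (hij.trans_le (Fin.le_last j)).ne
  obtain ⟨j, rfl⟩ := Fin.exists_succ_eq.2 ((Fin.zero_le _).trans_lt hij).ne'
  have hle : i ≤ j := Fin.castSucc_lt_succ_iff.1 hij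
  have h1 : stdSimplexDrop _ x hi j = 0 := by
    rw [stdSimplexDrop_apply, Fin.succAbove_of_le_castSucc _ _ (Fin.castSucc_le_castSucc_iff.2 hle),
      hj]
  have h2 : stdSimplexDrop _ x hj i = 0 := by
    rw [stdSimplexDrop_apply, Fin.succAbove_of_castSucc_lt _ _ hij, hi]
  have hw : stdSimplexDrop j _ h1 = stdSimplexDrop i _ h2 :=
    stdSimplex.ext (funext fun k =>
      congrArg (x : Fin (n + 3) → ℝ) (succ_succAbove_succAbove hle k).symm)
  rw [← map_stdSimplexDrop j _ h1, ← map_stdSimplexDrop i _ h2, ← Simplex.face_apply,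
    ← Simplex.face_apply, hs i j hle, hw]

/-- Simplices with matching faces glue to a map on the boundary of the simplex of the next
dimension. -/
theorem Simplex.exists_boundary_glue {n : ℕ} (s : Fin (n + 3) → Simplex (n + 1) X)
    (hs : ∀ i j : Fin (n + 2), i ≤ j → (s i.castSucc).face j = (s j.succ).face i) :
    ∃ u : C({x : stdSimplex ℝ (Fin (n + 3)) // ∃ i, x i = 0}, X),
      ∀ (x) (i) (hi : x.1 i = 0), u x = s i (stdSimplexDrop i x.1 hi) := by
  let u : {x : stdSimplex ℝ (Fin (n + 3)) // ∃ i, x i = 0} → X := fun x =>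
    s x.2.choose (stdSimplexDrop _ x.1 x.2.choose_spec)
  have hu : ∀ (x) (i) (hi : x.1 i = 0), u x = s i (stdSimplexDrop i x.1 hi) :=
    fun x i hi => Simplex.apply_drop_eq hs x.1 _ hi
  have hcoord : ∀ i : Fin (n + 3),
      Continuous fun x : {x : stdSimplex ℝ (Fin (n + 3)) // ∃ i, x i = 0} => x.1 i := fun i =>
    (continuous_apply i).comp (continuous_subtype_val.comp continuous_subtype_val)
  -- Continuity is checked on the finite closed cover by the faces.
  refine ⟨⟨u, (locallyFinite_of_finite fun i => {x | x.1 i = 0}).continuous ?_ ?_ ?_⟩, hu⟩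
  · exact eq_univ_of_forall fun x => mem_iUnion.2 x.2
  · exact fun i => isClosed_eq (hcoord i) continuous_const
  · intro i
    rw [continuousOn_iff_continuous_domRestrict]
    have : ({x | x.1 i = 0} : Set {x : stdSimplex ℝ (Fin (n + 3)) // ∃ i, x i = 0}).domRestrict u =
        fun x => s i (stdSimplexDrop i x.1.1 x.2) := funext fun x => hu x.1 i x.2
    rw [this]
    refine (s i).continuous.comp (Continuous.subtype_mk (continuous_pi fun k => ?_) _)
    exact (hcoord _).comp continuous_subtype_val

/-- If `π_{n+1}(X, b) = 0`, simplices of dimension `n + 1` with matching faces, one of which has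
`b` as a vertex, are the faces of a simplex. -/
theorem Simplex.exists_of_matching_faces {n : ℕ} {b : X}
    (hX : Subsingleton (HomotopyGroup.Pi (n + 1) X b)) (s : Fin (n + 3) → Simplex (n + 1) X)
    (hs : ∀ i j : Fin (n + 2), i ≤ j → (s i.castSucc).face j = (s j.succ).face i)
    (i₀ : Fin (n + 3)) (k₀ : Fin (n + 2)) (hb : s i₀ (stdSimplex.vertex k₀) = b) :
    ∃ t : Simplex (n + 2) X, ∀ i, t.face i = s i := by
  obtain ⟨u, hu⟩ := Simplex.exists_boundary_glue s hs
  have hmem (i : Fin (n + 3)) (y : stdSimplex ℝ (Fin (n + 2))) :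
      ∃ j, stdSimplex.map i.succAbove y j = 0 := ⟨i, stdSimplex_map_succAbove_self i y⟩
  have hface (i : Fin (n + 3)) (y : stdSimplex ℝ (Fin (n + 2))) :
      u ⟨stdSimplex.map i.succAbove y, hmem i y⟩ = s i y := by
    rw [hu _ i (stdSimplex_map_succAbove_self i y), stdSimplexDrop_map]
  obtain ⟨t, ht⟩ := exists_stdSimplex_extension (n := n + 1) hX u
    ⟨_, hmem i₀ (stdSimplex.vertex k₀)⟩ ((hface i₀ (stdSimplex.vertex k₀)).trans hb)
  refine ⟨t, fun i => ContinuousMap.ext fun y => ?_⟩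
  rw [Simplex.face_apply, ← hface i y]
  exact ht ⟨stdSimplex.map i.succAbove y, hmem i y⟩

end Simplices

/-! ### Triangles as homotopies between paths -/

section Paths

variable {X : Type*} [TopologicalSpace X]

/-- A path as a singular `1`-simplex. -/
def pathSimplex {a b : X} (p : Path a b) : Simplex 1 X :=
  p.toContinuousMap.comp
    ⟨stdSimplexHomeomorphUnitInterval, stdSimplexHomeomorphUnitInterval.continuous⟩

theorem pathSimplex_apply {a b : X} (p : Path a b) (x : stdSimplex ℝ (Fin 2)) :
    pathSimplex p x = p (stdSimplexHomeomorphUnitInterval x) :=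
  rfl

theorem pathSimplex_vertex_zero {a b : X} (p : Path a b) :
    pathSimplex p (stdSimplex.vertex 0) = a := by
  rw [pathSimplex_apply, stdSimplexHomeomorphUnitInterval_zero, p.source]

theorem pathSimplex_vertex_one {a b : X} (p : Path a b) :
    pathSimplex p (stdSimplex.vertex 1) = b := by
  rw [pathSimplex_apply, stdSimplexHomeomorphUnitInterval_one, p.target]

theorem pathSimplex_injective {a b : X} :
    Function.Injective (pathSimplex : Path a b → Simplex 1 X) := by
  intro p q h
  refine Path.ext (funext fun t => ?_)
  have := DFunLike.congr_fun h (stdSimplexHomeomorphUnitInterval.symm t)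
  rwa [pathSimplex_apply, pathSimplex_apply, Homeomorph.apply_symm_apply] at this

theorem comp_pathSimplex {Y : Type*} [TopologicalSpace Y] (f : C(X, Y)) {a b : X} (p : Path a b) :
    f.comp (pathSimplex p) = pathSimplex (p.map f.continuous) :=
  rfl

/-- A singular `1`-simplex as a path. -/
def Simplex.toPath (s : Simplex 1 X) {a b : X} (ha : s (stdSimplex.vertex 0) = a)
    (hb : s (stdSimplex.vertex 1) = b) : Path a b where
  toFun t := s (stdSimplexHomeomorphUnitInterval.symm t)
  source' := by
    rw [← ha, ← stdSimplexHomeomorphUnitInterval_zero, Homeomorph.symm_apply_apply]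
  target' := by
    rw [← hb, ← stdSimplexHomeomorphUnitInterval_one, Homeomorph.symm_apply_apply]

theorem pathSimplex_toPath (s : Simplex 1 X) {a b : X} (ha : s (stdSimplex.vertex 0) = a)
    (hb : s (stdSimplex.vertex 1) = b) : pathSimplex (s.toPath ha hb) = s :=
  ContinuousMap.ext fun x => congrArg s (stdSimplexHomeomorphUnitInterval.symm_apply_apply x)

theorem exists_pathSimplex_eq (s : Simplex 1 X) : ∃ (a b : X) (p : Path a b), pathSimplex p = s :=
  ⟨_, _, s.toPath rfl rfl, pathSimplex_toPath s rfl rfl⟩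

theorem Simplex.face_vertex {n : ℕ} (i : Fin (n + 2)) (s : Simplex (n + 1) X) (k : Fin (n + 1)) :
    s.face i (stdSimplex.vertex k) = s (stdSimplex.vertex (i.succAbove k)) := by
  rw [Simplex.face_apply, stdSimplex.map_vertex]

theorem Simplex.exists_edges (τ : Simplex 2 X) :
    ∃ (a b c : X) (p : Path a b) (q : Path b c) (r : Path a c),
      τ.face 2 = pathSimplex p ∧ τ.face 0 = pathSimplex q ∧ τ.face 1 = pathSimplex r :=
  ⟨τ (stdSimplex.vertex 0), τ (stdSimplex.vertex 1), τ (stdSimplex.vertex 2),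
    (τ.face 2).toPath (Simplex.face_vertex ..) (Simplex.face_vertex ..),
    (τ.face 0).toPath (Simplex.face_vertex ..) (Simplex.face_vertex ..),
    (τ.face 1).toPath (Simplex.face_vertex ..) (Simplex.face_vertex ..),
    (pathSimplex_toPath ..).symm, (pathSimplex_toPath ..).symm, (pathSimplex_toPath ..).symm⟩

/-- The parameter on an edge is the barycentric coordinate of its second vertex. -/
theorem Simplex.face_apply_symm {τ : Simplex 2 X} {i : Fin 3} {x : stdSimplex ℝ (Fin 3)}
    (hx : x i = 0) {t : I} (ht : x (i.succAbove 1) = t) :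
    τ.face i (stdSimplexHomeomorphUnitInterval.symm t) = τ x := by
  have hdrop : stdSimplexHomeomorphUnitInterval (stdSimplexDrop i x hx) = t := Subtype.ext ht
  rw [← hdrop, Homeomorph.symm_apply_apply, Simplex.face_apply, map_stdSimplexDrop]

theorem Simplex.apply_of_face_eq_pathSimplex {τ : Simplex 2 X} {i : Fin 3} {a b : X} {p : Path a b}
    (h : τ.face i = pathSimplex p) {x : stdSimplex ℝ (Fin 3)} (hx : x i = 0) {t : I}
    (ht : x (i.succAbove 1) = t) : τ x = p t := by
  rw [← Simplex.face_apply_symm hx ht, h, pathSimplex_apply, Homeomorph.apply_symm_apply]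

theorem Simplex.face_eq_pathSimplex {τ : Simplex 2 X} {i : Fin 3} {a b : X} {p : Path a b}
    (h : ∀ t : I, ∃ x : stdSimplex ℝ (Fin 3), x i = 0 ∧ x (i.succAbove 1) = t ∧ τ x = p t) :
    τ.face i = pathSimplex p := by
  refine ContinuousMap.ext fun y => ?_
  obtain ⟨t, rfl⟩ := stdSimplexHomeomorphUnitInterval.symm.surjective y
  obtain ⟨x, hx, ht, hp⟩ := h t
  rw [Simplex.face_apply_symm hx ht, hp, pathSimplex_apply, Homeomorph.apply_symm_apply]

/-- The square as a family of paths in the triangle from the vertex `0` to the vertex `2`, from the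
broken path through the vertex `1` to the opposite edge. -/
def squareToTriangle : C(I × I, stdSimplex ℝ (Fin 3)) where
  toFun z := ⟨![1 - z.2 - (1 - z.1) * min (z.2 : ℝ) (1 - z.2),
      2 * ((1 - z.1) * min (z.2 : ℝ) (1 - z.2)), z.2 - (1 - z.1) * min (z.2 : ℝ) (1 - z.2)], by
    obtain ⟨⟨s, hs0, hs1⟩, ⟨t, ht0, ht1⟩⟩ := z
    have hm : 0 ≤ min t (1 - t) := le_min ht0 (sub_nonneg.2 ht1)
    have h1 : (1 - s) * min t (1 - t) ≤ min t (1 - t) :=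
      mul_le_of_le_one_left hm (sub_le_self _ hs0)
    have h2 : 0 ≤ (1 - s) * min t (1 - t) := mul_nonneg (sub_nonneg.2 hs1) hm
    have h3 := min_le_left t (1 - t)
    have h4 := min_le_right t (1 - t)
    refine ⟨Fin.forall_fin_succ.2 ⟨?_, Fin.forall_fin_succ.2 ⟨?_, Fin.forall_fin_one.2 ?_⟩⟩, ?_⟩
    · change 0 ≤ 1 - t - (1 - s) * min t (1 - t)
      linarith
    · change 0 ≤ 2 * ((1 - s) * min t (1 - t))
      linarith
    · change 0 ≤ t - (1 - s) * min t (1 - t)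
      linarith
    · rw [Fin.sum_univ_three]
      change 1 - t - (1 - s) * min t (1 - t) + 2 * ((1 - s) * min t (1 - t)) +
        (t - (1 - s) * min t (1 - t)) = 1
      ring⟩
  continuous_toFun := by
    refine Continuous.subtype_mk (continuous_pi ?_) _
    refine Fin.forall_fin_succ.2 ⟨?_, Fin.forall_fin_succ.2 ⟨?_, Fin.forall_fin_one.2 ?_⟩⟩ <;>
    · simp
      fun_prop

theorem squareToTriangle_zero (z : I × I) :
    squareToTriangle z 0 = 1 - z.2 - (1 - z.1) * min (z.2 : ℝ) (1 - z.2) :=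
  rfl

theorem squareToTriangle_one (z : I × I) :
    squareToTriangle z 1 = 2 * ((1 - z.1) * min (z.2 : ℝ) (1 - z.2)) :=
  rfl

theorem squareToTriangle_two (z : I × I) :
    squareToTriangle z 2 = z.2 - (1 - z.1) * min (z.2 : ℝ) (1 - z.2) :=
  rfl

theorem squareToTriangle_surjective : Function.Surjective squareToTriangle := by
  intro x
  have hsum := stdSimplex.sum_eq_one x
  rw [Fin.sum_univ_three] at hsum
  have h0 := stdSimplex.zero_le x 0
  have h1 := stdSimplex.zero_le x 1
  have h2 := stdSimplex.zero_le x 2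
  -- The map satisfies `x 2 + x 1 / 2 = t`, which forces `t`; then `s` is solved from `x 1`. If `min
  -- t (1 - t) = 0`, then `x 1 = 0` and any `s` works.
  obtain ⟨t, ht⟩ : ∃ t, t = x 2 + x 1 / 2 := ⟨_, rfl⟩
  obtain ⟨s, hs0, hs1, hs⟩ : ∃ s : ℝ, 0 ≤ s ∧ s ≤ 1 ∧ (1 - s) * min t (1 - t) = x 1 / 2 := by
    have hle : x 1 / 2 ≤ min t (1 - t) := le_min (by linarith) (by linarith)
    rcases (show 0 ≤ x 1 / 2 by linarith).trans hle |>.eq_or_lt with h | h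
    · exact ⟨0, le_rfl, zero_le_one, by rw [← h] at hle ⊢; linarith⟩
    · refine ⟨1 - x 1 / 2 / min t (1 - t), ?_, ?_, ?_⟩
      · exact sub_nonneg.2 ((div_le_one h).2 hle)
      · exact sub_le_self _ (by positivity)
      · rw [sub_sub_cancel, div_mul_cancel₀ _ h.ne']
  refine ⟨(⟨s, hs0, hs1⟩, ⟨t, by linarith, by linarith⟩), stdSimplex.ext (funext ?_)⟩
  refine Fin.forall_fin_succ.2 ⟨?_, Fin.forall_fin_succ.2 ⟨?_, Fin.forall_fin_one.2 ?_⟩⟩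
  · change 1 - t - (1 - s) * min t (1 - t) = x 0
    linarith
  · change 2 * ((1 - s) * min t (1 - t)) = x 1
    linarith
  · change t - (1 - s) * min t (1 - t) = x 2
    linarith

/-- The only identifications collapse the sides `t = 0` and `t = 1`, on which a path homotopy is
constant. -/
theorem eq_of_squareToTriangle_eq {s s' t t' : I}
    (h : squareToTriangle (s, t) = squareToTriangle (s', t')) :
    t = t' ∧ (s = s' ∨ t = 0 ∨ t = 1) := by
  have h1 : 2 * ((1 - (s : ℝ)) * min (t : ℝ) (1 - t)) = 2 * ((1 - (s' : ℝ)) * min (t' : ℝ) (1 - t')) :=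
    congrArg (fun x : stdSimplex ℝ (Fin 3) => x 1) h
  have h2 : (t : ℝ) - (1 - (s : ℝ)) * min (t : ℝ) (1 - t) =
      t' - (1 - (s' : ℝ)) * min (t' : ℝ) (1 - t') :=
    congrArg (fun x : stdSimplex ℝ (Fin 3) => x 2) h
  obtain rfl : t = t' := Subtype.ext (by linarith)
  refine ⟨rfl, ?_⟩
  by_cases hm : min (t : ℝ) (1 - t) = 0
  · right
    rcases min_choice (t : ℝ) (1 - t) with h | h
    · exact Or.inl (Subtype.ext (h.symm.trans hm))
    · exact Or.inr (Subtype.ext (sub_eq_zero.1 (h.symm.trans hm)).symm)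
  · left
    have := mul_right_cancel₀ hm (mul_left_cancel₀ two_ne_zero h1)
    exact Subtype.ext (by linarith)

/-- The homotopy is `τ ∘ squareToTriangle`: at `s = 0` it runs along the edges `01` and `12` with
exactly the parametrization of `Path.trans`, at `s = 1` along the edge `02`. -/
theorem homotopic_of_faces {a b c : X} {p : Path a b} {q : Path b c} {r : Path a c}
    {τ : Simplex 2 X} (hp : τ.face 2 = pathSimplex p) (hq : τ.face 0 = pathSimplex q)
    (hr : τ.face 1 = pathSimplex r) : (p.trans q).Homotopic r := by
  have h0 : ∀ t, τ (squareToTriangle (0, t)) = p.trans q t := by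
    intro t
    rw [Path.trans_apply]
    split_ifs with ht
    · have hmin : min (t : ℝ) (1 - t) = t := min_eq_left (by linarith)
      refine Simplex.apply_of_face_eq_pathSimplex hp ?_ ?_
      · rw [squareToTriangle_two, hmin]
        simp
      · change squareToTriangle (0, t) 1 = 2 * (t : ℝ)
        rw [squareToTriangle_one, hmin]
        simp
    · have hmin : min (t : ℝ) (1 - t) = 1 - t := min_eq_right (by linarith)
      refine Simplex.apply_of_face_eq_pathSimplex hq ?_ ?_
      · rw [squareToTriangle_zero, hmin]
        simp
      · change squareToTriangle (0, t) 2 = 2 * (t : ℝ) - 1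
        rw [squareToTriangle_two, hmin]
        simp
        ring
  have h1 : ∀ t, τ (squareToTriangle (1, t)) = r t := by
    intro t
    refine Simplex.apply_of_face_eq_pathSimplex hr ?_ ?_
    · rw [squareToTriangle_one]
      simp
    · change squareToTriangle (1, t) 2 = t
      rw [squareToTriangle_two]
      simp
  refine ⟨⟨⟨τ.comp squareToTriangle, h0, h1⟩, ?_⟩⟩
  intro s t ht
  change τ (squareToTriangle (s, t)) = p.trans q t
  rw [← h0]
  congr 1
  have hm : min (t : ℝ) (1 - t) = 0 := by
    rcases ht with rfl | rfl <;> simp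
  refine stdSimplex.ext (funext ?_)
  refine Fin.forall_fin_succ.2 ⟨?_, Fin.forall_fin_succ.2 ⟨?_, Fin.forall_fin_one.2 ?_⟩⟩
  · change squareToTriangle (s, t) 0 = squareToTriangle (0, t) 0
    simp [squareToTriangle_zero, hm]
  · change squareToTriangle (s, t) 1 = squareToTriangle (0, t) 1
    simp [squareToTriangle_one, hm]
  · change squareToTriangle (s, t) 2 = squareToTriangle (0, t) 2
    simp [squareToTriangle_two, hm]

/-- A homotopy relative to endpoints is constant on the fibres of the quotient map
`squareToTriangle`, so it descends to the triangle. -/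
theorem exists_simplex_of_homotopic {a b c : X} {p : Path a b} {q : Path b c} {r : Path a c}
    (h : (p.trans q).Homotopic r) :
    ∃ τ : Simplex 2 X, τ.face 2 = pathSimplex p ∧ τ.face 0 = pathSimplex q ∧
      τ.face 1 = pathSimplex r := by
  obtain ⟨H⟩ := h
  have hquot : Topology.IsQuotientMap squareToTriangle :=
    squareToTriangle.continuous.isClosedMap.isQuotientMap squareToTriangle.continuous
      squareToTriangle_surjective
  have hfac : Function.FactorsThrough H.toContinuousMap squareToTriangle := by
    rintro ⟨s, t⟩ ⟨s', t'⟩ hz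
    change H (s, t) = H (s', t')
    obtain ⟨rfl, rfl | rfl | rfl⟩ := eq_of_squareToTriangle_eq hz
    · rfl
    · rw [H.source, H.source]
    · rw [H.target, H.target]
  obtain ⟨τ, hτ⟩ : ∃ τ : Simplex 2 X, ∀ s t, τ (squareToTriangle (s, t)) = H (s, t) :=
    ⟨hquot.lift H.toContinuousMap hfac, fun s t =>
      DFunLike.congr_fun (hquot.lift_comp H.toContinuousMap hfac) (s, t)⟩
  have hτ0 : ∀ t, τ (squareToTriangle (0, t)) = p.trans q t := fun t =>
    (hτ 0 t).trans (H.apply_zero t)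
  have hτ1 : ∀ t, τ (squareToTriangle (1, t)) = r t := fun t => (hτ 1 t).trans (H.apply_one t)
  refine ⟨τ, Simplex.face_eq_pathSimplex fun t => ?_, Simplex.face_eq_pathSimplex fun t => ?_,
    Simplex.face_eq_pathSimplex fun t => ?_⟩
  · have hmem : (t : ℝ) / 2 ∈ I := ⟨by linarith [t.2.1], by linarith [t.2.2]⟩
    have hmin : min ((t : ℝ) / 2) (1 - t / 2) = t / 2 := min_eq_left (by linarith [t.2.2])
    refine ⟨squareToTriangle (0, ⟨t / 2, hmem⟩), ?_, ?_, ?_⟩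
    · simp [squareToTriangle_two, hmin]
    · change squareToTriangle (0, ⟨t / 2, hmem⟩) 1 = t
      simp only [squareToTriangle_one, hmin, Icc.coe_zero]
      ring
    · rw [hτ0, Path.trans_apply, dif_pos (by change (t : ℝ) / 2 ≤ 1 / 2; linarith [t.2.2])]
      exact congrArg p (Subtype.ext (mul_div_cancel₀ _ two_ne_zero))
  · have hmem : (1 + (t : ℝ)) / 2 ∈ I := ⟨by linarith [t.2.1], by linarith [t.2.2]⟩
    have hmin : min ((1 + (t : ℝ)) / 2) (1 - (1 + t) / 2) = 1 - (1 + t) / 2 :=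
      min_eq_right (by linarith [t.2.1])
    refine ⟨squareToTriangle (0, ⟨(1 + t) / 2, hmem⟩), ?_, ?_, ?_⟩
    · simp [squareToTriangle_zero, hmin]
    · change squareToTriangle (0, ⟨(1 + t) / 2, hmem⟩) 2 = t
      simp only [squareToTriangle_two, hmin, Icc.coe_zero]
      ring
    · rw [hτ0, Path.trans_apply]
      -- The first half of the concatenation is reached only at `t = 0`, where both pieces take the
      -- value `b`.
      split_ifs with ht
      · obtain rfl : t = 0 := by
          have ht' : (1 + (t : ℝ)) / 2 ≤ 1 / 2 := ht
          exact Subtype.ext (le_antisymm (by change (t : ℝ) ≤ 0; linarith) t.2.1)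
        rw [q.source]
        convert p.target using 2
        exact Subtype.ext (by simp)
      · exact congrArg q (Subtype.ext (by simp; ring))
  · refine ⟨squareToTriangle (1, t), ?_, ?_, hτ1 t⟩
    · simp [squareToTriangle_one]
    · change squareToTriangle (1, t) 2 = t
      simp [squareToTriangle_two]

end Paths

/-! ### Injectivity on second cohomology -/

section Injectivity

variable {B M : Type*} [TopologicalSpace B] [TopologicalSpace M]

/-- A `2`-cocycle vanishes on four triangles which form the boundary of a tetrahedron, if the
last vertex is a point `b` with `π₂(B, b) = 0`. -/
theorem cocycle_apply_boundary {b : B} (hB : Subsingleton (HomotopyGroup.Pi 2 B b))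
    {c : Cochain 2 B} (hc : c ∈ cocycles 2 B) {s₀ s₁ s₂ s₃ : Simplex 2 B} {a : B} {p : Path a b}
    (hp : s₀.face 0 = pathSimplex p) (h₀₁ : s₀.face 0 = s₁.face 0) (h₀₂ : s₀.face 1 = s₂.face 0)
    (h₀₃ : s₀.face 2 = s₃.face 0) (h₁₂ : s₁.face 1 = s₂.face 1) (h₁₃ : s₁.face 2 = s₃.face 1)
    (h₂₃ : s₂.face 2 = s₃.face 2) : c s₀ - c s₁ + c s₂ - c s₃ = 0 := by
  have hmatch : ∀ i j : Fin 3, i ≤ j →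
      Simplex.face j ((![s₀, s₁, s₂, s₃] : Fin 4 → Simplex 2 B) i.castSucc) =
        Simplex.face i ((![s₀, s₁, s₂, s₃] : Fin 4 → Simplex 2 B) j.succ) := by
    intro i j hij
    fin_cases i <;> fin_cases j
    exacts [h₀₁, h₀₂, h₀₃, absurd hij (by decide), h₁₂, h₁₃, absurd hij (by decide),
      absurd hij (by decide), h₂₃]
  -- Vertex `2` of the face opposite vertex `0` is the last vertex of the tetrahedron; it puts the
  -- base point of `π₂` on the boundary to be filled.
  have hb : s₀ (stdSimplex.vertex 2) = b := by
    have h := Simplex.face_vertex 0 s₀ 1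
    rw [hp, pathSimplex_vertex_one] at h
    exact h.symm
  obtain ⟨t, ht⟩ := Simplex.exists_of_matching_faces (n := 1) hB ![s₀, s₁, s₂, s₃] hmatch 0 2 hb
  have hδ : coboundary 2 B c t = 0 := congrFun (show coboundary 2 B c = 0 from hc) t
  change ∑ i : Fin 4, (-1) ^ (i : ℕ) * c (t.face i) = 0 at hδ
  simp only [ht, Fin.sum_univ_four] at hδ
  change (-1) ^ 0 * c s₀ + (-1) ^ 1 * c s₁ + (-1) ^ 2 * c s₂ + (-1) ^ 3 * c s₃ = 0 at hδ
  linarith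

/-- The prism over a path `e`, moved along paths `P` to a loop `γ` in the image of `f`. -/
structure IsLoopReplacement (f : C(M, B)) {x₀ : M} (P : ∀ y : B, Path y (f x₀)) {a a' : B}
    (e : Path a a') (γ : Path x₀ x₀) (T S : Simplex 2 B) : Prop where
  homotopic : (e.trans (P a')).Homotopic ((P a).trans (γ.map f.continuous))
  lower_zero : T.face 0 = pathSimplex (P a')
  lower_one : T.face 1 = pathSimplex (e.trans (P a'))
  lower_two : T.face 2 = pathSimplex e
  upper_zero : S.face 0 = pathSimplex (γ.map f.continuous)
  upper_one : S.face 1 = pathSimplex (e.trans (P a'))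
  upper_two : S.face 2 = pathSimplex (P a)

/-- The data are to depend on the 1-simplex alone, since they enter the value of a cochain on it.
Quantifying over all paths `e` with `pathSimplex e = edge` lets the endpoints be supplied later by
the surrounding triangle. -/
theorem exists_isLoopReplacement (f : C(M, B)) {x₀ : M} (P : ∀ y : B, Path y (f x₀))
    (hsurj : ∀ g : Path (f x₀) (f x₀), ∃ γ : Path x₀ x₀, (γ.map f.continuous).Homotopic g)
    (edge : Simplex 1 B) :
    ∃ (γ : Path x₀ x₀) (T S : Simplex 2 B), ∀ (a a' : B) (e : Path a a'), pathSimplex e = edge →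
      IsLoopReplacement f P e γ T S := by
  obtain ⟨a, a', e, rfl⟩ := exists_pathSimplex_eq edge
  -- The loop at `f x₀` that goes back along `P a`, along `e`, then along `P a'`, lifted up to
  -- homotopy to `M`.
  obtain ⟨γ, hγ⟩ := hsurj ((P a).symm.trans (e.trans (P a')))
  have hhom : (e.trans (P a')).Homotopic ((P a).trans (γ.map f.continuous)) := by
    rw [← Path.Homotopic.Quotient.eq] at hγ ⊢
    rw [Path.Homotopic.Quotient.mk_trans (P a), hγ]
    simp only [Path.Homotopic.Quotient.mk_trans, Path.Homotopic.Quotient.mk_symm]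
    rw [← Path.Homotopic.Quotient.trans_assoc, Path.Homotopic.Quotient.trans_symm,
      Path.Homotopic.Quotient.refl_trans]
  obtain ⟨T, hT₂, hT₀, hT₁⟩ := exists_simplex_of_homotopic (Path.Homotopic.refl (e.trans (P a')))
  obtain ⟨S, hS₂, hS₀, hS₁⟩ := exists_simplex_of_homotopic hhom.symm
  refine ⟨γ, T, S, fun d d' e' h => ?_⟩
  obtain rfl : d = a := by rw [← pathSimplex_vertex_zero e', h, pathSimplex_vertex_zero]
  obtain rfl : d' = a' := by rw [← pathSimplex_vertex_one e', h, pathSimplex_vertex_one]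
  obtain rfl := pathSimplex_injective h
  exact ⟨hhom, hT₀, hT₁, hT₂, hS₀, hS₁, hS₂⟩

/-- A `2`-cocycle on `B` whose pullback under `f` is a coboundary is a coboundary, if `f` induces
an isomorphism of fundamental groups and `π₂(B) = 0`. -/
theorem exists_coboundary_eq [PathConnectedSpace B] (f : C(M, B)) {x₀ : M}
    (hB : Subsingleton (HomotopyGroup.Pi 2 B (f x₀)))
    (hsurj : ∀ g : Path (f x₀) (f x₀), ∃ γ : Path x₀ x₀, (γ.map f.continuous).Homotopic g)
    (hinj : ∀ γ γ' : Path x₀ x₀, (γ.map f.continuous).Homotopic (γ'.map f.continuous) →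
      γ.Homotopic γ')
    {c : Cochain 2 B} (hc : c ∈ cocycles 2 B) {b : Cochain 1 M}
    (hb : coboundary 1 M b = cochainMap 2 f c) : ∃ b', coboundary 1 B b' = c := by
  let P : ∀ y : B, Path y (f x₀) := fun y => PathConnectedSpace.somePath y (f x₀)
  choose γ T S hγ using exists_isLoopReplacement f P hsurj
  -- The loop term alone would give a primitive of `c` on the deformed edges; `c (T edge) - c (S
  -- edge)` corrects for the deformation.
  refine ⟨fun edge => c (T edge) - c (S edge) + b (pathSimplex (γ edge)), funext fun τ => ?_⟩
  obtain ⟨v₀, v₁, v₂, e₀₁, e₁₂, e₀₂, h₂, h₀, h₁⟩ := τ.exists_edges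
  have hτ := homotopic_of_faces h₂ h₀ h₁
  have k₀₁ := hγ (τ.face 2) _ _ e₀₁ h₂.symm
  have k₁₂ := hγ (τ.face 0) _ _ e₁₂ h₀.symm
  have k₀₂ := hγ (τ.face 1) _ _ e₀₂ h₁.symm
  have hY : ((e₀₁.trans (P v₁)).trans ((γ (τ.face 0)).map f.continuous)).Homotopic
      (e₀₂.trans (P v₂)) := by
    have q₁₂ := k₁₂.homotopic
    rw [← Path.Homotopic.Quotient.eq] at q₁₂ hτ ⊢
    simp only [Path.Homotopic.Quotient.mk_trans] at q₁₂ hτ ⊢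
    rw [Path.Homotopic.Quotient.trans_assoc, ← q₁₂, ← Path.Homotopic.Quotient.trans_assoc, hτ]
  have hX : (e₀₁.trans (e₁₂.trans (P v₂))).Homotopic (e₀₂.trans (P v₂)) := by
    rw [← Path.Homotopic.Quotient.eq] at hτ ⊢
    simp only [Path.Homotopic.Quotient.mk_trans] at hτ ⊢
    rw [← Path.Homotopic.Quotient.trans_assoc, hτ]
  -- In `B` the images of the three loops satisfy the relation of the edges of `τ`; injectivity on
  -- `π₁` lifts it to `M`, giving the triangle `D` on which `b` can be used.
  have hD : ((γ (τ.face 2)).trans (γ (τ.face 0))).Homotopic (γ (τ.face 1)) := by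
    refine hinj _ _ ?_
    have q₀₁ := k₀₁.homotopic
    have q₀₂ := k₀₂.homotopic
    rw [Path.map_trans]
    rw [← Path.Homotopic.Quotient.eq] at q₀₁ q₀₂ hY ⊢
    simp only [Path.Homotopic.Quotient.mk_trans] at q₀₁ q₀₂ hY ⊢
    rw [q₀₁, q₀₂, Path.Homotopic.Quotient.trans_assoc] at hY
    have := congrArg (Path.Homotopic.Quotient.trans (Path.Homotopic.Quotient.mk (P v₀)).symm) hY
    simpa only [← Path.Homotopic.Quotient.trans_assoc, Path.Homotopic.Quotient.symm_trans,
      Path.Homotopic.Quotient.refl_trans] using this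
  obtain ⟨X, hX₂, hX₀, hX₁⟩ := exists_simplex_of_homotopic hX
  obtain ⟨Y, hY₂, hY₀, hY₁⟩ := exists_simplex_of_homotopic hY
  obtain ⟨D, hD₂, hD₀, hD₁⟩ := exists_simplex_of_homotopic hD
  have hfD (i : Fin 3) : Simplex.face i (f.comp D : Simplex 2 B) = f.comp (D.face i) := rfl
  -- Writing `*` for `f x₀`, the tetrahedra have vertices `(v₀, v₁, v₂, *)`, `(v₀, v₁, *, *)` and
  -- `(v₀, *, *, *)`. The first two share the face `X`, the last two the face `Y`.
  have z₁ := cocycle_apply_boundary hB hc (s₀ := T (τ.face 0)) (s₁ := T (τ.face 1)) (s₂ := X)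
    (s₃ := τ) k₁₂.lower_zero (k₁₂.lower_zero.trans k₀₂.lower_zero.symm)
    (k₁₂.lower_one.trans hX₀.symm) (k₁₂.lower_two.trans h₀.symm) (k₀₂.lower_one.trans hX₁.symm)
    (k₀₂.lower_two.trans h₁.symm) (hX₂.trans h₂.symm)
  have z₂ := cocycle_apply_boundary hB hc (s₀ := S (τ.face 0)) (s₁ := Y) (s₂ := X)
    (s₃ := T (τ.face 2)) k₁₂.upper_zero (k₁₂.upper_zero.trans hY₀.symm)
    (k₁₂.upper_one.trans hX₀.symm) (k₁₂.upper_two.trans k₀₁.lower_zero.symm) (hY₁.trans hX₁.symm)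
    (hY₂.trans k₀₁.lower_one.symm) (hX₂.trans k₀₁.lower_two.symm)
  have z₃ := cocycle_apply_boundary hB hc (s₀ := f.comp D) (s₁ := Y) (s₂ := S (τ.face 1))
    (s₃ := S (τ.face 2)) (p := (γ (τ.face 0)).map f.continuous)
    (by rw [hfD, hD₀, comp_pathSimplex]) (by rw [hfD, hD₀, comp_pathSimplex, hY₀])
    (by rw [hfD, hD₁, comp_pathSimplex, k₀₂.upper_zero])
    (by rw [hfD, hD₂, comp_pathSimplex, k₀₁.upper_zero]) (hY₁.trans k₀₂.upper_one.symm)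
    (hY₂.trans k₀₁.upper_one.symm) (k₀₂.upper_two.trans k₀₁.upper_two.symm)
  have hbD : ∑ i : Fin 3, (-1) ^ (i : ℕ) * b (D.face i) = c (f.comp D) := congrFun hb D
  rw [Fin.sum_univ_three, hD₀, hD₁, hD₂] at hbD
  change ∑ i : Fin 3, (-1) ^ (i : ℕ) *
    (c (T (τ.face i)) - c (S (τ.face i)) + b (pathSimplex (γ (τ.face i)))) = c τ
  rw [Fin.sum_univ_three]
  simp only [Fin.val_zero, Fin.val_one, Fin.val_two, pow_zero, pow_one, one_mul, neg_mul, neg_one_sq]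
    at hbD ⊢
  -- In `z₁ - z₂ + z₃` the terms `c X` and `c Y` cancel, and `hbD` replaces `c (f.comp D)` by the
  -- values of `b` on the three loops.
  linarith

/-- Bijectivity on `π₁` is unpacked into lifting of loops and of homotopies, and injectivity is
tested on a cocycle whose pullback is a coboundary. -/
theorem cohomology_map_two_injective_of_bijective [PathConnectedSpace B] (f : C(M, B)) {x₀ : M}
    {b : B} (h : f x₀ = b) (hB : Subsingleton (HomotopyGroup.Pi 2 B b))
    (hf : Function.Bijective (FundamentalGroup.mapOfEq f h)) :
    Function.Injective (Cohomology.map 2 f) := by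
  subst h
  have hmk (γ : Path x₀ x₀) : FundamentalGroup.mapOfEq f rfl
      (FundamentalGroup.fromPath (Path.Homotopic.Quotient.mk γ)) =
      Path.Homotopic.Quotient.mk (γ.map f.continuous) := by
    rw [FundamentalGroup.mapOfEq_apply, Path.Homotopic.Quotient.cast_rfl_rfl]
    rfl
  have hsurj (g : Path (f x₀) (f x₀)) :
      ∃ γ : Path x₀ x₀, (γ.map f.continuous).Homotopic g := by
    obtain ⟨q, hq⟩ := hf.2 (FundamentalGroup.fromPath (Path.Homotopic.Quotient.mk g))
    obtain ⟨γ, rfl⟩ := Path.Homotopic.Quotient.mk_surjective q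
    exact ⟨γ, Path.Homotopic.Quotient.exact ((hmk γ).symm.trans hq)⟩
  have hinj (γ γ' : Path x₀ x₀)
      (hγ : (γ.map f.continuous).Homotopic (γ'.map f.continuous)) : γ.Homotopic γ' :=
    Path.Homotopic.Quotient.exact (hf.1 ((hmk γ).trans
      ((Path.Homotopic.Quotient.eq.2 hγ).trans (hmk γ').symm)))
  rw [← LinearMap.ker_eq_bot, LinearMap.ker_eq_bot']
  intro x hx
  obtain ⟨c, rfl⟩ := Submodule.Quotient.mk_surjective _ x
  obtain ⟨d, hd⟩ := (Submodule.Quotient.mk_eq_zero _).1 hx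
  exact (Submodule.Quotient.mk_eq_zero _).2 (exists_coboundary_eq f hB hsurj hinj c.2 hd)

theorem cohomology_map_two_injective {G : Type*} [Group G] (K : EilenbergMacLane G B) {x₀ : M}
    (φ : FundamentalGroup M x₀ ≃* G) (f : C(M, B)) (based : f x₀ = K.base)
    (induces : ∀ γ, K.iso (FundamentalGroup.mapOfEq f based γ) = φ γ) :
    Function.Injective (Cohomology.map 2 f) := by
  have := K.t2
  have := K.connected
  obtain ⟨_⟩ := K.cw
  have : PathConnectedSpace B := pathConnectedSpace_of_cwComplex
  refine cohomology_map_two_injective_of_bijective f based (K.aspherical 2 le_rfl) ?_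
  rw [← K.iso.bijective.of_comp_iff', show K.iso ∘ _ = φ from funext induces]
  exact φ.bijective

end Injectivity

end GroupGeography

end

/-! ### The main theorem -/

open GroupGeography in
theorem mainTheorem2
    {G : Type*} [Group G] {B : Type*} [TopologicalSpace B] (K : EilenbergMacLane G B)
    (α : Homology 4 B)
    {M : Type*} [TopologicalSpace M] [T2Space M] [CompactSpace M] [ConnectedSpace M]
    [ChartedSpace (EuclideanSpace ℝ (Fin 4)) M]
    (c : Homology 4 M) {x₀ : M} (φ : FundamentalGroup M x₀ ≃* G) (f : C(M, B))
    (hM : MemM K α c φ f) :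
    Function.Injective (Cohomology.map 2 f) ∧
    (∀ x y : Cohomology 2 B,
      intersectionForm c (pullbackModTorsion f x) (pullbackModTorsion f y) = cupPairing α x y) ∧
    (∃ e : ModTorsion (Cohomology 2 B) ≃ₗ[ℤ] imageI f,
      (∀ x : Cohomology 2 B,
        (e (Submodule.Quotient.mk x) : ModTorsion (Cohomology 2 M)) = pullbackModTorsion f x) ∧
      ∀ x y, restrictForm (intersectionForm c) (imageI f) (e x) (e y) =
        formModTorsion (cupPairing α) x y) ∧
    (bPlus (restrictForm (intersectionForm c) (imageI f)) ≤ bPlus (intersectionForm c) ∧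
      bMinus (restrictForm (intersectionForm c) (imageI f)) ≤ bMinus (intersectionForm c)) ∧
    (∀ W : Submodule ℤ (Cohomology 2 B), IsIsotropic (cupPairing α) W →
      IsIsotropic (intersectionForm c) (W.map (pullbackModTorsion f))) ∧
    (IsEvenForm (cupPairing α) →
      IsEvenForm (restrictForm (intersectionForm c) (imageI f))) ∧
    (imageI f = ⊤ → ∃ e : ModTorsion (Cohomology 2 B) ≃ₗ[ℤ] ModTorsion (Cohomology 2 M),
      (∀ x : Cohomology 2 B, e (Submodule.Quotient.mk x) = pullbackModTorsion f x) ∧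
      ∀ x y, intersectionForm c (e x) (e y) = formModTorsion (cupPairing α) x y) ∧
    (Function.Surjective (Cohomology.map 2 f) → imageI f = ⊤) := by
  have hinj : Function.Injective (Cohomology.map 2 f) :=
    cohomology_map_two_injective K φ f hM.based hM.induces
  have hform : ∀ x y : Cohomology 2 B,
      intersectionForm c (pullbackModTorsion f x) (pullbackModTorsion f y) = cupPairing α x y := by
    intro x y
    rw [intersectionForm_pullbackModTorsion, hM.map_class]
  have hiso : ∀ x y : ModTorsion (Cohomology 2 B),
      intersectionForm c (modTorsionEquivImageI f hinj x) (modTorsionEquivImageI f hinj y) =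
        formModTorsion (cupPairing α) x y := by
    intro x y
    obtain ⟨x, rfl⟩ := Submodule.Quotient.mk_surjective _ x
    obtain ⟨y, rfl⟩ := Submodule.Quotient.mk_surjective _ y
    rw [coe_modTorsionEquivImageI_mk, coe_modTorsionEquivImageI_mk, hform]
    rfl
  refine ⟨hinj, hform, ⟨modTorsionEquivImageI f hinj, coe_modTorsionEquivImageI_mk f hinj, hiso⟩,
    ⟨bPlus_restrictForm_le _ _, bMinus_restrictForm_le _ _⟩, ?_, ?_, ?_, ?_⟩
  · rintro W hW _ ⟨x, hx, rfl⟩ _ ⟨y, hy, rfl⟩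
    rw [hform, hW x hx y hy]
  · rintro h ⟨_, x, rfl⟩
    change Even (intersectionForm c (pullbackModTorsion f x) (pullbackModTorsion f x))
    rw [hform]
    exact h x
  · intro htop
    exact ⟨(modTorsionEquivImageI f hinj).trans (LinearEquiv.ofTop _ htop),
      coe_modTorsionEquivImageI_mk f hinj, hiso⟩
  · intro hsurj
    exact LinearMap.range_eq_top.2 ((Submodule.mkQ_surjective _).comp hsurj)
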